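/- Let $\mathcal O$ be a complete discrete valuation ring with field of fractions of characteristic $0$ and finite residue field $k$ of characteristic $p$ with $q=p^h$ elements, and let $\pi$ be a uniformizing parameter of $\mathcal O$. Write $W$ for $p$-typical Witt vectors and view $\mathcal O$ as a $W(k)$-algebra via the unique ring homomorphism $W(k)\to\mathcal O$ inducing the identity on $k$. The Greenberg algebra $\mathbb R_{\mathcal O}$ is the affine $k$-scheme of $\mathcal O$-algebras with $\mathbb R_{\mathcal O}(A)=W(A)\otimes_{W(k)}\mathcal O$ for every $k$-algebra $A$. For an $\mathcal O$-algebra $B$, the $\mathcal O$-algebra of ramified Witt vectors $W_{\mathcal O}(B)$ is the set $B^{\mathbb N_0}$ with the $\mathcal O$-algebra structure, natural in $B$, for which $(b_n)_n\mapsto\bigl(\sum_{i=0}^{n}\pi^i b_i^{q^{n-i}}\bigr)_n$ is a homomorphism of $\mathcal O$-algebras to the product algebra $B^{\mathbb N_0}$; it is represented by an affine $\mathcal O$-scheme $\mathbb W_{\mathcal O}$ of $\mathcal O$-algebras, with special fiber $\mathbb W_{\mathcal O,k}=\mathbb W_{\mathcal O}\times_{\mathcal O}\operatorname{Spec}k$.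 Let $u\colon W(B)\to W_{\mathcal O}(B)$ be the Drinfeld map, i.e. the ring homomorphism, natural in the $\mathcal O$-algebra $B$, such that $\sum_{i=0}^{n}\pi^i u(\boldsymbol b)_i^{q^{n-i}}=\sum_{i=0}^{hn}p^i b_i^{p^{hn-i}}$ for all $n\ge 0$ and $\boldsymbol b\in W(B)$. For $k$-algebras $A$, the homomorphisms of $\mathcal O$-algebras $r_A=u\otimes\mathrm{id}_{\mathcal O}\colon W(A)\otimes_{W(k)}\mathcal O\to W_{\mathcal O}(A)$ define a morphism of ring schemes over $k$ $$\boldsymbol r\colon \mathbb R_{\mathcal O}\to\mathbb W_{\mathcal O,k}.$$ For a $k$-scheme $X$ let $X^{\mathrm{pf}}$ be its inverse perfection, the inverse limit of copies of $X$ with the absolute ($p$-power) Frobenius as transition maps. Then: 1. $\boldsymbol r$ induces an isomorphism $\boldsymbol r^{\mathrm{pf}}\colon\mathbb R_{\mathcal O}^{\mathrm{pf}}\to\mathbb W_{\mathcal O,k}^{\mathrm{pf}}$; 2. $\boldsymbol r$ is a universal homeomorphism, in particular it is surjective; 3. the kernel of $\boldsymbol r$, i.e. the commutative $k$-group scheme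 $A\mapsto\ker(r_A)$, is pro-infinitesimal: it is a cofiltered inverse limit of infinitesimal commutative $k$-group schemes, that is, of $k$-group schemes whose underlying scheme is the spectrum of a finite-dimensional local $k$-algebra. -/

import Mathlib

open CategoryTheory Limits AlgebraicGeometry IsLocalRing TensorProduct

universe u v

noncomputable section

/-- A uniformizing parameter of a discrete valuation ring. -/
abbrev Uniformizer (O : Type u) [CommRing O] : Type u := {ϖ : O // Irreducible ϖ}

namespace RamifiedWitt

/-! ### Congruences and the image of the ghost map -/

section Congruence

variable {B : Type v} [CommRing B]

/-- The `n`-th ghost component `b₀ ^ q ^ n + w * b₁ ^ q ^ (n - 1) + ... + w ^ n * bₙ`. -/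
def ghost (w : B) (q : ℕ) (b : ℕ → B) (n : ℕ) : B :=
  ∑ i ∈ Finset.range (n + 1), w ^ i * b i ^ q ^ (n - i)

theorem map_ghost {C : Type*} [CommRing C] (f : B →+* C) (w : B) (q : ℕ) (b : ℕ → B) (n : ℕ) :
    f (ghost w q b n) = ghost (f w) q (fun i => f (b i)) n := by
  simp [ghost, map_sum]

theorem pow_dvd_pow_sub_pow {w x y : B} {m : ℕ} (hm : w ∣ (m : B)) (h : w ∣ x - y) (j : ℕ) :
    w ^ (j + 1) ∣ x ^ m ^ j - y ^ m ^ j := by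
  induction j with
  | zero => simpa using h
  | succ j ih =>
    rw [pow_succ m, pow_mul, pow_mul, ← (Commute.all _ _).mul_geom_sum₂, pow_succ]
    refine mul_dvd_mul ih ?_
    rw [dvd_geom_sum₂_iff_of_dvd_sub ((dvd_pow_self w (Nat.succ_ne_zero j)).trans ih)]
    exact hm.mul_right _

theorem pow_dvd_ghost_sub {w : B} {q : ℕ} {σ : B →+* B} (hw : σ w = w) (hq : w ∣ (q : B))
    (hσ : ∀ b, w ∣ σ b - b ^ q) (b : ℕ → B) (n : ℕ) :
    w ^ (n + 1) ∣ (∑ i ∈ Finset.range (n + 1), w ^ i * b i ^ q ^ (n + 1 - i)) -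
      σ (ghost w q b n) := by
  rw [map_ghost, ghost, ← Finset.sum_sub_distrib]
  refine Finset.dvd_sum fun i hi => ?_
  have hi : i ≤ n := Nat.lt_succ_iff.mp (Finset.mem_range.mp hi)
  have h1 : n + 1 - i = (n - i) + 1 := by omega
  rw [hw, ← mul_sub, h1, pow_succ' q, pow_mul, show n + 1 = i + ((n - i) + 1) by omega, pow_add]
  refine mul_dvd_mul_left _ ?_
  rw [← dvd_neg, neg_sub]
  exact pow_dvd_pow_sub_pow hq (hσ _) _

theorem pow_dvd_ghost_succ_sub {w : B} {q : ℕ} {σ : B →+* B} (hw : σ w = w) (hq : w ∣ (q : B))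
    (hσ : ∀ b, w ∣ σ b - b ^ q) (b : ℕ → B) (n : ℕ) :
    w ^ (n + 1) ∣ ghost w q b (n + 1) - σ (ghost w q b n) := by
  rw [show ghost w q b (n + 1) = (∑ i ∈ Finset.range (n + 1), w ^ i * b i ^ q ^ (n + 1 - i)) +
    w ^ (n + 1) * b (n + 1) by simp [ghost, Finset.sum_range_succ _ (n + 1)], add_sub_right_comm]
  exact dvd_add (pow_dvd_ghost_sub hw hq hσ b n) (dvd_mul_right _ _)

theorem exists_ghost_eq {w : B} {q : ℕ} {σ : B →+* B} (hw : σ w = w) (hq : w ∣ (q : B))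
    (hσ : ∀ b, w ∣ σ b - b ^ q) (a : ℕ → B) (ha : ∀ n, w ^ (n + 1) ∣ a (n + 1) - σ (a n)) :
    ∃ b : ℕ → B, ∀ n, ghost w q b n = a n := by
  have key : ∀ n, ∀ b : ℕ → B, (∀ m < n, ghost w q b m = a m) →
      ∃ c, ∀ m ≤ n, ghost w q (Function.update b n c) m = a m := by
    intro n b hb
    obtain ⟨c, hc⟩ : w ^ n ∣ a n - ∑ i ∈ Finset.range n, w ^ i * b i ^ q ^ (n - i) := by
      cases n with
      | zero => simp
      | succ n =>
        have h1 := ha n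
        rw [← hb n (Nat.lt_succ_self n)] at h1
        have h2 := pow_dvd_ghost_sub hw hq hσ b n
        have := dvd_sub h1 h2
        rwa [sub_sub_sub_cancel_right] at this
    refine ⟨c, fun m hm => ?_⟩
    have hlt : ∀ i < n, Function.update b n c i = b i := fun i hi =>
      Function.update_of_ne hi.ne _ _
    rcases hm.lt_or_eq with h | rfl
    · rw [← hb m h]
      exact Finset.sum_congr rfl fun i hi => by
        rw [hlt i (by have := Finset.mem_range.mp hi; omega)]
    · rw [ghost, Finset.sum_range_succ, Finset.sum_congr rfl fun i hi => by
        rw [hlt i (Finset.mem_range.mp hi)]]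
      simp [← hc]
  choose! c hc using key
  let s : ℕ → ℕ → B := fun n => Nat.rec (fun _ => 0) (fun n b => Function.update b n (c n b)) n
  have hs : ∀ n, s (n + 1) = Function.update (s n) n (c n (s n)) := fun n => rfl
  have hg : ∀ n, ∀ m < n, ghost w q (s n) m = a m := by
    intro n
    induction n with
    | zero => intro m hm; omega
    | succ n ih => intro m hm; rw [hs]; exact hc n (s n) ih m (Nat.lt_succ_iff.mp hm)
  have hst : ∀ n i, i < n → s n i = s (i + 1) i := by
    intro n i hi
    induction n with
    | zero => omega
    | succ n ih =>
      rcases (Nat.lt_succ_iff.mp hi).lt_or_eq with h | rfl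
      · rw [hs, Function.update_of_ne h.ne, ih h]
      · rfl
  refine ⟨fun i => s (i + 1) i, fun n => ?_⟩
  rw [← hg (n + 1) n (Nat.lt_succ_self n)]
  exact Finset.sum_congr rfl fun i hi => by rw [hst (n + 1) i (Finset.mem_range.mp hi)]

theorem ghost_injective {w : B} (hw : w ∈ nonZeroDivisors B) (q : ℕ) {b c : ℕ → B}
    (h : ∀ n, ghost w q b n = ghost w q c n) : b = c := by
  funext n
  induction n using Nat.strong_induction_on with
  | _ n ih =>
    have := h n
    rw [ghost, ghost, Finset.sum_range_succ, Finset.sum_range_succ,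
      Finset.sum_congr rfl fun i hi => by rw [ih i (Finset.mem_range.mp hi)]] at this
    have h2 := add_left_cancel this
    simp only [Nat.sub_self, pow_zero, pow_one] at h2
    exact (mul_cancel_left_mem_nonZeroDivisors (pow_mem hw n)).mp h2

end Congruence

/-! ### The base ring -/

section Base

variable {O : Type u} [CommRing O] [IsDomain O] [IsDiscreteValuationRing O]
  [Finite (ResidueField O)]

theorem uniformizer_dvd_iff (ϖ : Uniformizer O) (x : O) : ϖ.1 ∣ x ↔ residue O x = 0 := by
  rw [residue_eq_zero_iff, ϖ.2.maximalIdeal_eq, Ideal.mem_span_singleton]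

theorem uniformizer_dvd_sub_iff (ϖ : Uniformizer O) (x y : O) :
    ϖ.1 ∣ x - y ↔ residue O x = residue O y := by
  rw [uniformizer_dvd_iff, map_sub, sub_eq_zero]

theorem card_pos_exponent (p : ℕ) [Fact p.Prime] [CharP (ResidueField O) p] :
    Nat.card (ResidueField O) = p ^ Nat.log p (Nat.card (ResidueField O)) ∧
      0 < Nat.log p (Nat.card (ResidueField O)) := by
  have := Fintype.ofFinite (ResidueField O)
  obtain ⟨n, -, hn⟩ := FiniteField.card (ResidueField O) p
  rw [Nat.card_eq_fintype_card, hn, Nat.log_pow (Fact.out : p.Prime).one_lt]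
  exact ⟨rfl, n.2⟩

theorem residue_pow_card (x : ResidueField O) : x ^ Nat.card (ResidueField O) = x := by
  have := Fintype.ofFinite (ResidueField O)
  rw [Nat.card_eq_fintype_card, FiniteField.pow_card]

theorem dvd_prime (ϖ : Uniformizer O) (p : ℕ) [CharP (ResidueField O) p] : ϖ.1 ∣ (p : O) := by
  rw [uniformizer_dvd_iff, map_natCast, CharP.cast_eq_zero]

theorem dvd_card (ϖ : Uniformizer O) : ϖ.1 ∣ (Nat.card (ResidueField O) : O) := by
  have := Fintype.ofFinite (ResidueField O)
  rw [uniformizer_dvd_iff, map_natCast, Nat.card_eq_fintype_card, FiniteField.cast_card_eq_zero]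

theorem dvd_pow_card_sub (ϖ : Uniformizer O) (x : O) :
    ϖ.1 ∣ x - x ^ Nat.card (ResidueField O) := by
  rw [uniformizer_dvd_sub_iff, map_pow, residue_pow_card]

/-- The lift of the `q`-Frobenius to a polynomial ring that raises the variables to the
power `q`. -/
def frobLift (O : Type u) [CommRing O] [IsLocalRing O] (I : Type*) :
    MvPolynomial I O →ₐ[O] MvPolynomial I O :=
  MvPolynomial.aeval fun i => MvPolynomial.X i ^ Nat.card (ResidueField O)

theorem dvd_frobLift_sub (ϖ : Uniformizer O) {I : Type*} (b : MvPolynomial I O) :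
    algebraMap O (MvPolynomial I O) ϖ.1 ∣ frobLift O I b - b ^ Nat.card (ResidueField O) := by
  obtain ⟨p, hp⟩ := CharP.exists (ResidueField O)
  have hpp : Fact p.Prime := ⟨(CharP.char_is_prime_or_zero (ResidueField O) p).resolve_right
    (CharP.char_ne_zero_of_finite (ResidueField O) p)⟩
  obtain ⟨hq, -⟩ := card_pos_exponent (O := O) p
  have hdp : algebraMap O (MvPolynomial I O) ϖ.1 ∣ (p : MvPolynomial I O) := by
    simpa using map_dvd (algebraMap O (MvPolynomial I O)) (dvd_prime ϖ p)
  induction b using MvPolynomial.induction_on with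
  | C a =>
    have : frobLift O I (MvPolynomial.C a) = MvPolynomial.C a := by
      simp [frobLift, MvPolynomial.algebraMap_eq]
    rw [this, ← map_pow, ← map_sub, ← MvPolynomial.algebraMap_eq]
    exact map_dvd _ (dvd_pow_card_sub ϖ a)
  | add a b ha hb =>
    have h : algebraMap O (MvPolynomial I O) ϖ.1 ∣
        (a + b) ^ Nat.card (ResidueField O) -
          (a ^ Nat.card (ResidueField O) + b ^ Nat.card (ResidueField O)) := by
      rw [hq]
      obtain ⟨r, hr⟩ := exists_add_pow_prime_pow_eq hpp.out a b
        (Nat.log p (Nat.card (ResidueField O)))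
      rw [hr, add_sub_cancel_left, mul_assoc, mul_assoc]
      exact hdp.mul_right _
    have h2 := dvd_sub (dvd_add ha hb) h
    rw [map_add]
    convert h2 using 1
    ring
  | mul_X a i ha =>
    rw [map_mul, mul_pow, show frobLift O I (MvPolynomial.X i) =
      MvPolynomial.X i ^ Nat.card (ResidueField O) by simp [frobLift], ← sub_mul]
    exact ha.mul_right _

theorem algebraMap_uniformizer_mem (ϖ : Uniformizer O) (I : Type*) :
    algebraMap O (MvPolynomial I O) ϖ.1 ∈ nonZeroDivisors (MvPolynomial I O) := by
  rw [mem_nonZeroDivisors_iff_ne_zero, MvPolynomial.algebraMap_eq, Ne, MvPolynomial.C_eq_zero]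
  exact ϖ.2.ne_zero

theorem exists_polynomials (ϖ : Uniformizer O) {I : Type*} (a : ℕ → MvPolynomial I O)
    (ha : ∀ n, algebraMap O (MvPolynomial I O) ϖ.1 ^ (n + 1) ∣ a (n + 1) - frobLift O I (a n)) :
    ∃ b : ℕ → MvPolynomial I O, ∀ n,
      ghost (algebraMap O _ ϖ.1) (Nat.card (ResidueField O)) b n = a n :=
  exists_ghost_eq (σ := (frobLift O I : MvPolynomial I O →+* MvPolynomial I O))
    ((frobLift O I).commutes _) (by simpa using map_dvd (algebraMap O (MvPolynomial I O)) (dvd_card ϖ))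
    (dvd_frobLift_sub ϖ) a ha

theorem dvd_ghost_X (ϖ : Uniformizer O) {I : Type*} (b : ℕ → MvPolynomial I O) (n : ℕ) :
    algebraMap O (MvPolynomial I O) ϖ.1 ^ (n + 1) ∣
      ghost (algebraMap O _ ϖ.1) (Nat.card (ResidueField O)) b (n + 1) -
        frobLift O I (ghost (algebraMap O _ ϖ.1) (Nat.card (ResidueField O)) b n) :=
  pow_dvd_ghost_succ_sub (σ := (frobLift O I : MvPolynomial I O →+* MvPolynomial I O))
    ((frobLift O I).commutes _) (by simpa using map_dvd (algebraMap O (MvPolynomial I O)) (dvd_card ϖ))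
    (dvd_frobLift_sub ϖ) b n

end Base

end RamifiedWitt

namespace RamifiedWitt

/-! ### Structure polynomials -/

section Polynomials

variable {O : Type u} [CommRing O] [IsDomain O] [IsDiscreteValuationRing O]
  [Finite (ResidueField O)]

/-- The ghost components, with respect to the uniformizer `ϖ`, of a sequence in an
`O`-algebra. -/
abbrev gh (ϖ : Uniformizer O) {B : Type v} [CommRing B] [Algebra O B] (b : ℕ → B) (n : ℕ) : B :=
  ghost (algebraMap O B ϖ.1) (Nat.card (ResidueField O)) b n

theorem exists_addPoly (ϖ : Uniformizer O) : ∃ S : ℕ → MvPolynomial (ℕ ⊕ ℕ) O, ∀ n,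
    gh ϖ S n = gh ϖ (fun i => MvPolynomial.X (Sum.inl i)) n +
      gh ϖ (fun i => MvPolynomial.X (Sum.inr i)) n := by
  refine exists_polynomials ϖ _ fun n => ?_
  rw [map_add, add_sub_add_comm]
  exact dvd_add (dvd_ghost_X ϖ _ n) (dvd_ghost_X ϖ _ n)

theorem exists_mulPoly (ϖ : Uniformizer O) : ∃ M : ℕ → MvPolynomial (ℕ ⊕ ℕ) O, ∀ n,
    gh ϖ M n = gh ϖ (fun i => MvPolynomial.X (Sum.inl i)) n *
      gh ϖ (fun i => MvPolynomial.X (Sum.inr i)) n := by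
  refine exists_polynomials ϖ _ fun n => ?_
  rw [map_mul]
  exact dvd_mul_sub_mul (dvd_ghost_X ϖ _ n) (dvd_ghost_X ϖ _ n)

theorem exists_negPoly (ϖ : Uniformizer O) : ∃ N : ℕ → MvPolynomial ℕ O, ∀ n,
    gh ϖ N n = -gh ϖ (fun i => MvPolynomial.X i) n := by
  refine exists_polynomials ϖ _ fun n => ?_
  rw [map_neg, ← neg_sub_neg, neg_neg, neg_neg, ← dvd_neg, neg_sub]
  exact dvd_ghost_X ϖ _ n

/-- The polynomials giving the sum of ramified Witt vectors. -/
def addPoly (ϖ : Uniformizer O) : ℕ → MvPolynomial (ℕ ⊕ ℕ) O := (exists_addPoly ϖ).choose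

/-- The polynomials giving the product of ramified Witt vectors. -/
def mulPoly (ϖ : Uniformizer O) : ℕ → MvPolynomial (ℕ ⊕ ℕ) O := (exists_mulPoly ϖ).choose

/-- The polynomials giving the opposite of a ramified Witt vector. -/
def negPoly (ϖ : Uniformizer O) : ℕ → MvPolynomial ℕ O := (exists_negPoly ϖ).choose

theorem gh_map (ϖ : Uniformizer O) {B C : Type*} [CommRing B] [CommRing C] [Algebra O B]
    [Algebra O C] (f : B →ₐ[O] C) (b : ℕ → B) (n : ℕ) :
    f (gh ϖ b n) = gh ϖ (fun i => f (b i)) n := by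
  have := map_ghost (f : B →+* C) (algebraMap O B ϖ.1) (Nat.card (ResidueField O)) b n
  simpa using this

end Polynomials

end RamifiedWitt

/-! ### Ramified Witt vectors -/

/-- The set `W_O(B)` of ramified Witt vectors with coefficients in an `O`-algebra `B`,
with respect to the uniformizer `ϖ` of `O`. -/
@[ext]
structure RWitt {O : Type u} [CommRing O] (ϖ : Uniformizer O) (B : Type v) where
  /-- The components of a ramified Witt vector. -/
  coeff : ℕ → B

namespace RWitt

open RamifiedWitt

variable {O : Type u} [CommRing O] [IsDomain O] [IsDiscreteValuationRing O]
  [Finite (ResidueField O)] {ϖ : Uniformizer O}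

section Ring

variable {B : Type v} {C : Type*} [CommRing B] [Algebra O B] [CommRing C] [Algebra O C]

instance : Zero (RWitt ϖ B) := ⟨⟨fun _ => 0⟩⟩

instance : One (RWitt ϖ B) := ⟨⟨fun n => if n = 0 then 1 else 0⟩⟩

instance : Add (RWitt ϖ B) :=
  ⟨fun x y => ⟨fun n => MvPolynomial.aeval (Sum.elim x.coeff y.coeff) (addPoly ϖ n)⟩⟩

instance : Mul (RWitt ϖ B) :=
  ⟨fun x y => ⟨fun n => MvPolynomial.aeval (Sum.elim x.coeff y.coeff) (mulPoly ϖ n)⟩⟩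

instance : Neg (RWitt ϖ B) :=
  ⟨fun x => ⟨fun n => MvPolynomial.aeval x.coeff (negPoly ϖ n)⟩⟩

/-- The ghost map `Φ_B`. -/
def ghostFun (x : RWitt ϖ B) (n : ℕ) : B := gh ϖ x.coeff n

theorem ghostFun_zero (n : ℕ) : ghostFun (0 : RWitt ϖ B) n = 0 := by
  have hq : Nat.card (ResidueField O) ≠ 0 := Nat.card_pos.ne'
  rw [ghostFun, gh, ghost]
  refine Finset.sum_eq_zero fun i _ => ?_
  change _ * (0 : B) ^ _ = 0
  rw [zero_pow (pow_ne_zero _ hq), mul_zero]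

theorem ghostFun_one (n : ℕ) : ghostFun (1 : RWitt ϖ B) n = 1 := by
  have hq : Nat.card (ResidueField O) ≠ 0 := Nat.card_pos.ne'
  have h : ∀ i, (1 : RWitt ϖ B).coeff i = if i = 0 then 1 else 0 := fun i => rfl
  rw [ghostFun, gh, ghost, Finset.sum_range_succ', Finset.sum_eq_zero]
  · simp [h]
  · intro i _
    rw [h, if_neg (Nat.succ_ne_zero i), zero_pow (pow_ne_zero _ hq), mul_zero]

theorem ghostFun_add (x y : RWitt ϖ B) (n : ℕ) :
    ghostFun (x + y) n = ghostFun x n + ghostFun y n := by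
  have h := congrArg (MvPolynomial.aeval (Sum.elim x.coeff y.coeff))
    ((exists_addPoly ϖ).choose_spec n)
  rw [map_add, gh_map, gh_map, gh_map] at h
  simp only [MvPolynomial.aeval_X, Sum.elim_inl, Sum.elim_inr] at h
  exact h

theorem ghostFun_mul (x y : RWitt ϖ B) (n : ℕ) :
    ghostFun (x * y) n = ghostFun x n * ghostFun y n := by
  have h := congrArg (MvPolynomial.aeval (Sum.elim x.coeff y.coeff))
    ((exists_mulPoly ϖ).choose_spec n)
  rw [map_mul, gh_map, gh_map, gh_map] at h
  simp only [MvPolynomial.aeval_X, Sum.elim_inl, Sum.elim_inr] at h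
  exact h

theorem ghostFun_neg (x : RWitt ϖ B) (n : ℕ) : ghostFun (-x) n = -ghostFun x n := by
  have h := congrArg (MvPolynomial.aeval x.coeff) ((exists_negPoly ϖ).choose_spec n)
  rw [map_neg, gh_map, gh_map] at h
  simp only [MvPolynomial.aeval_X] at h
  exact h

theorem ghostFun_injective (hB : algebraMap O B ϖ.1 ∈ nonZeroDivisors B) {x y : RWitt ϖ B}
    (h : ∀ n, ghostFun x n = ghostFun y n) : x = y :=
  RWitt.ext (ghost_injective hB _ h)

/-- The map on ramified Witt vectors induced by a homomorphism of `O`-algebras. -/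
def mapFun (f : B →ₐ[O] C) (x : RWitt ϖ B) : RWitt ϖ C := ⟨fun n => f (x.coeff n)⟩

theorem mapFun_zero (f : B →ₐ[O] C) : mapFun f (0 : RWitt ϖ B) = 0 :=
  RWitt.ext (funext fun _ => map_zero f)

theorem mapFun_one (f : B →ₐ[O] C) : mapFun f (1 : RWitt ϖ B) = 1 := by
  refine RWitt.ext (funext fun n => ?_)
  change f (if n = 0 then 1 else 0) = if n = 0 then 1 else 0
  split_ifs <;> simp

theorem map_aeval_sum (f : B →ₐ[O] C) (x y : ℕ → B) (P : MvPolynomial (ℕ ⊕ ℕ) O) :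
    f (MvPolynomial.aeval (Sum.elim x y) P) =
      MvPolynomial.aeval (Sum.elim (fun n => f (x n)) (fun n => f (y n))) P := by
  rw [← AlgHom.comp_apply, MvPolynomial.comp_aeval]
  congr 2
  funext i
  cases i <;> rfl

theorem mapFun_add (f : B →ₐ[O] C) (x y : RWitt ϖ B) :
    mapFun f (x + y) = mapFun f x + mapFun f y :=
  RWitt.ext (funext fun _ => map_aeval_sum f _ _ _)

theorem mapFun_mul (f : B →ₐ[O] C) (x y : RWitt ϖ B) :
    mapFun f (x * y) = mapFun f x * mapFun f y :=
  RWitt.ext (funext fun _ => map_aeval_sum f _ _ _)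

theorem mapFun_neg (f : B →ₐ[O] C) (x : RWitt ϖ B) : mapFun f (-x) = -mapFun f x :=
  RWitt.ext (funext fun n => by
    change f (MvPolynomial.aeval _ _) = MvPolynomial.aeval _ _
    rw [← AlgHom.comp_apply, MvPolynomial.comp_aeval]
    rfl)

variable (O B) in
/-- Every `O`-algebra is a quotient of a polynomial ring over `O`. -/
def cover : MvPolynomial B O →ₐ[O] B := MvPolynomial.aeval id

theorem exists_mapFun_cover (x : RWitt ϖ B) :
    ∃ y : RWitt ϖ (MvPolynomial B O), mapFun (cover O B) y = x :=
  ⟨⟨fun n => MvPolynomial.X (x.coeff n)⟩, RWitt.ext (funext fun n => by simp [cover, mapFun])⟩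

theorem ghostFun_injective_cover {x y : RWitt ϖ (MvPolynomial B O)}
    (h : ∀ n, ghostFun x n = ghostFun y n) : x = y :=
  ghostFun_injective (algebraMap_uniformizer_mem ϖ B) h

/-- The ring structure on `W_O(B)`: it is natural in `B` and makes the ghost map a ring
homomorphism. -/
instance : CommRing (RWitt ϖ B) where
  add_assoc x y z := by
    obtain ⟨x, rfl⟩ := exists_mapFun_cover x
    obtain ⟨y, rfl⟩ := exists_mapFun_cover y
    obtain ⟨z, rfl⟩ := exists_mapFun_cover z
    simp only [← mapFun_add]
    exact congrArg _ (ghostFun_injective_cover fun n => by simp only [ghostFun_add, add_assoc])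
  zero_add x := by
    obtain ⟨x, rfl⟩ := exists_mapFun_cover x
    rw [← mapFun_zero (cover O B), ← mapFun_add]
    exact congrArg _ (ghostFun_injective_cover fun n => by
      simp only [ghostFun_add, ghostFun_zero, zero_add])
  add_zero x := by
    obtain ⟨x, rfl⟩ := exists_mapFun_cover x
    rw [← mapFun_zero (cover O B), ← mapFun_add]
    exact congrArg _ (ghostFun_injective_cover fun n => by
      simp only [ghostFun_add, ghostFun_zero, add_zero])
  add_comm x y := by
    obtain ⟨x, rfl⟩ := exists_mapFun_cover x
    obtain ⟨y, rfl⟩ := exists_mapFun_cover y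
    simp only [← mapFun_add]
    exact congrArg _ (ghostFun_injective_cover fun n => by simp only [ghostFun_add, add_comm])
  neg_add_cancel x := by
    obtain ⟨x, rfl⟩ := exists_mapFun_cover x
    rw [← mapFun_zero (cover O B), ← mapFun_neg, ← mapFun_add]
    exact congrArg _ (ghostFun_injective_cover fun n => by
      simp only [ghostFun_add, ghostFun_neg, ghostFun_zero, neg_add_cancel])
  mul_assoc x y z := by
    obtain ⟨x, rfl⟩ := exists_mapFun_cover x
    obtain ⟨y, rfl⟩ := exists_mapFun_cover y
    obtain ⟨z, rfl⟩ := exists_mapFun_cover z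
    simp only [← mapFun_mul]
    exact congrArg _ (ghostFun_injective_cover fun n => by simp only [ghostFun_mul, mul_assoc])
  mul_comm x y := by
    obtain ⟨x, rfl⟩ := exists_mapFun_cover x
    obtain ⟨y, rfl⟩ := exists_mapFun_cover y
    simp only [← mapFun_mul]
    exact congrArg _ (ghostFun_injective_cover fun n => by simp only [ghostFun_mul, mul_comm])
  one_mul x := by
    obtain ⟨x, rfl⟩ := exists_mapFun_cover x
    rw [← mapFun_one (cover O B), ← mapFun_mul]
    exact congrArg _ (ghostFun_injective_cover fun n => by
      simp only [ghostFun_mul, ghostFun_one, one_mul])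
  mul_one x := by
    obtain ⟨x, rfl⟩ := exists_mapFun_cover x
    rw [← mapFun_one (cover O B), ← mapFun_mul]
    exact congrArg _ (ghostFun_injective_cover fun n => by
      simp only [ghostFun_mul, ghostFun_one, mul_one])
  left_distrib x y z := by
    obtain ⟨x, rfl⟩ := exists_mapFun_cover x
    obtain ⟨y, rfl⟩ := exists_mapFun_cover y
    obtain ⟨z, rfl⟩ := exists_mapFun_cover z
    simp only [← mapFun_mul, ← mapFun_add]
    exact congrArg _ (ghostFun_injective_cover fun n => by
      simp only [ghostFun_mul, ghostFun_add, left_distrib])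
  right_distrib x y z := by
    obtain ⟨x, rfl⟩ := exists_mapFun_cover x
    obtain ⟨y, rfl⟩ := exists_mapFun_cover y
    obtain ⟨z, rfl⟩ := exists_mapFun_cover z
    simp only [← mapFun_mul, ← mapFun_add]
    exact congrArg _ (ghostFun_injective_cover fun n => by
      simp only [ghostFun_mul, ghostFun_add, right_distrib])
  zero_mul x := by
    obtain ⟨x, rfl⟩ := exists_mapFun_cover x
    rw [← mapFun_zero (cover O B), ← mapFun_mul]
    exact congrArg _ (ghostFun_injective_cover fun n => by
      simp only [ghostFun_mul, ghostFun_zero, zero_mul])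
  mul_zero x := by
    obtain ⟨x, rfl⟩ := exists_mapFun_cover x
    rw [← mapFun_zero (cover O B), ← mapFun_mul]
    exact congrArg _ (ghostFun_injective_cover fun n => by
      simp only [ghostFun_mul, ghostFun_zero, mul_zero])
  nsmul := nsmulRec
  zsmul := zsmulRec

/-- Functoriality of `W_O`. -/
def map (f : B →ₐ[O] C) : RWitt ϖ B →+* RWitt ϖ C where
  toFun := mapFun f
  map_zero' := mapFun_zero f
  map_one' := mapFun_one f
  map_add' := mapFun_add f
  map_mul' := mapFun_mul f

theorem map_coeff (f : B →ₐ[O] C) (x : RWitt ϖ B) (n : ℕ) :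
    (map f x).coeff n = f (x.coeff n) := rfl

end Ring

/-! ### The structure of `O`-algebra on `W_O(B)` -/

section Algebra

theorem exists_scalar (ϖ : Uniformizer O) (c : O) : ∃ b : ℕ → O, ∀ n, gh ϖ b n = c :=
  exists_ghost_eq (σ := RingHom.id O) rfl (dvd_card ϖ) (dvd_pow_card_sub ϖ) (fun _ => c)
    fun n => by simp

/-- The homomorphism `O → W_O(O)` whose ghost components are all the identity. -/
def scalar (ϖ : Uniformizer O) : O →+* RWitt ϖ O where
  toFun c := ⟨(exists_scalar ϖ c).choose⟩
  map_zero' := ghostFun_injective (mem_nonZeroDivisors_of_ne_zero ϖ.2.ne_zero) fun n => by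
    rw [ghostFun_zero]; exact (exists_scalar ϖ 0).choose_spec n
  map_one' := ghostFun_injective (mem_nonZeroDivisors_of_ne_zero ϖ.2.ne_zero) fun n => by
    rw [ghostFun_one]; exact (exists_scalar ϖ 1).choose_spec n
  map_add' x y := ghostFun_injective (mem_nonZeroDivisors_of_ne_zero ϖ.2.ne_zero) fun n => by
    rw [ghostFun_add, ghostFun, ghostFun, ghostFun, (exists_scalar ϖ _).choose_spec,
      (exists_scalar ϖ _).choose_spec, (exists_scalar ϖ _).choose_spec]
  map_mul' x y := ghostFun_injective (mem_nonZeroDivisors_of_ne_zero ϖ.2.ne_zero) fun n => by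
    rw [ghostFun_mul, ghostFun, ghostFun, ghostFun, (exists_scalar ϖ _).choose_spec,
      (exists_scalar ϖ _).choose_spec, (exists_scalar ϖ _).choose_spec]

theorem ghostFun_scalar (ϖ : Uniformizer O) (c : O) (n : ℕ) : ghostFun (scalar ϖ c) n = c :=
  (exists_scalar ϖ c).choose_spec n

/-- The structure of `O`-algebra on `W_O(B)`, for which the ghost map is a homomorphism
of `O`-algebras. -/
instance (B : Type v) [CommRing B] [Algebra O B] : Algebra O (RWitt ϖ B) :=
  ((map (Algebra.ofId O B)).comp (scalar ϖ)).toAlgebra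

theorem algebraMap_coeff {B : Type v} [CommRing B] [Algebra O B] (c : O) (n : ℕ) :
    (algebraMap O (RWitt ϖ B) c).coeff n = algebraMap O B ((scalar ϖ c).coeff n) := rfl

theorem map_algebraMap {B : Type v} {C : Type*} [CommRing B] [Algebra O B] [CommRing C]
    [Algebra O C] (f : B →ₐ[O] C) (c : O) :
    map f (algebraMap O (RWitt ϖ B) c) = algebraMap O (RWitt ϖ C) c :=
  RWitt.ext (funext fun n => by rw [map_coeff, algebraMap_coeff, algebraMap_coeff, f.commutes])

end Algebra

/-! ### The Drinfeld map -/

section Drinfeld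

variable (p : ℕ) [Fact p.Prime] [CharP (ResidueField O) p]

theorem exists_drinfeldPoly (ϖ : Uniformizer O) : ∃ U : ℕ → MvPolynomial ℕ O, ∀ n,
    gh ϖ U n = ghost (p : MvPolynomial ℕ O) p MvPolynomial.X
      (Nat.log p (Nat.card (ResidueField O)) * n) := by
  obtain ⟨hq, hh⟩ := card_pos_exponent (O := O) p
  have hp : algebraMap O (MvPolynomial ℕ O) ϖ.1 ∣ (p : MvPolynomial ℕ O) := by
    simpa using map_dvd (algebraMap O (MvPolynomial ℕ O)) (dvd_prime ϖ p)
  refine exists_polynomials ϖ _ fun n => ?_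
  have hF := dvd_frobLift_sub ϖ (I := ℕ)
  generalize Nat.log p (Nat.card (ResidueField O)) = h at hq hh
  set w := algebraMap O (MvPolynomial ℕ O) ϖ.1
  have hle : n ≤ h * n := Nat.le_mul_of_pos_left n hh
  have hlt : h * n + 1 ≤ h * (n + 1) + 1 := by rw [Nat.mul_succ]; omega
  have hmap := map_ghost (frobLift O ℕ : MvPolynomial ℕ O →+* MvPolynomial ℕ O)
    (p : MvPolynomial ℕ O) p MvPolynomial.X (h * n)
  rw [RingHom.coe_coe] at hmap
  rw [hmap, ghost, ← Finset.sum_range_add_sum_Ico _ hlt, ghost, add_sub_right_comm,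
    ← Finset.sum_sub_distrib]
  refine dvd_add (Finset.dvd_sum fun i hi => ?_) (Finset.dvd_sum fun i hi => ?_)
  · have hi : i ≤ h * n := Nat.lt_succ_iff.mp (Finset.mem_range.mp hi)
    rw [map_natCast, ← mul_sub, Nat.mul_succ, show h * n + h - i = h + (h * n - i) by omega,
      pow_add p, ← hq, pow_mul]
    refine (pow_dvd_pow w (show n + 1 ≤ i + (h * n - i + 1) by omega)).trans ?_
    rw [pow_add]
    refine mul_dvd_mul (pow_dvd_pow_of_dvd hp i) ?_
    rw [← dvd_neg, neg_sub]
    exact pow_dvd_pow_sub_pow hp (hF _) _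
  · have hi : h * n + 1 ≤ i := (Finset.mem_Ico.mp hi).1
    exact ((pow_dvd_pow w (show n + 1 ≤ i by omega)).trans (pow_dvd_pow_of_dvd hp i)).mul_right _

/-- The polynomials giving the Drinfeld map `W(B) → W_O(B)`. -/
def drinfeldPoly (ϖ : Uniformizer O) : ℕ → MvPolynomial ℕ O := (exists_drinfeldPoly p ϖ).choose

variable {B : Type v} {C : Type*} [CommRing B] [Algebra O B] [CommRing C] [Algebra O C]

/-- The Drinfeld map `W(B) → W_O(B)` as a map of sets. -/
def drinfeldFun (ϖ : Uniformizer O) (x : WittVector p B) : RWitt ϖ B :=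
  ⟨fun n => MvPolynomial.aeval x.coeff (drinfeldPoly p ϖ n)⟩

theorem ghostFun_drinfeldFun (x : WittVector p B) (n : ℕ) :
    ghostFun (drinfeldFun p ϖ x) n =
      WittVector.ghostComponent (Nat.log p (Nat.card (ResidueField O)) * n) x := by
  have h := congrArg (MvPolynomial.aeval x.coeff) ((exists_drinfeldPoly p ϖ).choose_spec n)
  have h2 := map_ghost (MvPolynomial.aeval (R := O) x.coeff : MvPolynomial ℕ O →+* B)
    (p : MvPolynomial ℕ O) p MvPolynomial.X (Nat.log p (Nat.card (ResidueField O)) * n)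
  rw [RingHom.coe_coe] at h2
  rw [gh_map, h2] at h
  simp only [MvPolynomial.aeval_X, map_natCast] at h
  refine h.trans ?_
  rw [WittVector.ghostComponent_apply, aeval_wittPolynomial, ghost]

theorem mapFun_drinfeldFun (f : B →ₐ[O] C) (x : WittVector p B) :
    mapFun f (drinfeldFun p ϖ x) = drinfeldFun p ϖ (WittVector.map (f : B →+* C) x) :=
  RWitt.ext (funext fun n => by
    change f (MvPolynomial.aeval _ _) = MvPolynomial.aeval _ _
    rw [← AlgHom.comp_apply, MvPolynomial.comp_aeval]
    congr 2)

theorem exists_map_cover (x : WittVector p B) :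
    ∃ y : WittVector p (MvPolynomial B O),
      WittVector.map (cover O B : MvPolynomial B O →+* B) y = x :=
  WittVector.map_surjective _ (fun b => ⟨MvPolynomial.X b, by simp [cover]⟩) x

/-- The Drinfeld map `u : W(B) → W_O(B)`, for which `Φ_n (u x)` is the `(h * n)`-th ghost
component of `x`, where the residue field of `O` has `p ^ h` elements. -/
def drinfeld (ϖ : Uniformizer O) (B : Type v) [CommRing B] [Algebra O B] :
    WittVector p B →+* RWitt ϖ B where
  toFun := drinfeldFun p ϖ
  map_zero' := by
    rw [← map_zero (WittVector.map (cover O B : MvPolynomial B O →+* B)), ← mapFun_drinfeldFun,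
      ← mapFun_zero (cover O B)]
    exact congrArg _ (ghostFun_injective_cover fun n => by
      rw [ghostFun_drinfeldFun, map_zero, ghostFun_zero])
  map_one' := by
    rw [← map_one (WittVector.map (cover O B : MvPolynomial B O →+* B)), ← mapFun_drinfeldFun,
      ← mapFun_one (cover O B)]
    exact congrArg _ (ghostFun_injective_cover fun n => by
      rw [ghostFun_drinfeldFun, map_one, ghostFun_one])
  map_add' x y := by
    obtain ⟨x, rfl⟩ := exists_map_cover (O := O) p x
    obtain ⟨y, rfl⟩ := exists_map_cover (O := O) p y
    rw [← map_add]
    simp only [← mapFun_drinfeldFun, ← mapFun_add]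
    exact congrArg _ (ghostFun_injective_cover fun n => by
      simp only [ghostFun_drinfeldFun, map_add, ghostFun_add])
  map_mul' x y := by
    obtain ⟨x, rfl⟩ := exists_map_cover (O := O) p x
    obtain ⟨y, rfl⟩ := exists_map_cover (O := O) p y
    rw [← map_mul]
    simp only [← mapFun_drinfeldFun, ← mapFun_mul]
    exact congrArg _ (ghostFun_injective_cover fun n => by
      simp only [ghostFun_drinfeldFun, map_mul, ghostFun_mul])

theorem map_drinfeld (f : B →ₐ[O] C) (x : WittVector p B) :
    map f (drinfeld p ϖ B x) = drinfeld p ϖ C (WittVector.map (f : B →+* C) x) :=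
  mapFun_drinfeldFun p f x

theorem drinfeld_coeff_zero (x : WittVector p B) : (drinfeld p ϖ B x).coeff 0 = x.coeff 0 := by
  change (drinfeldFun p ϖ x).coeff 0 = _
  have := ghostFun_drinfeldFun p (ϖ := ϖ) x 0
  simpa [ghostFun, gh, ghost, WittVector.ghostComponent_apply, wittPolynomial_zero] using this

end Drinfeld

end RWitt

/-! ### The canonical homomorphism `W(k) → O` -/

namespace RamifiedWitt

section Base

variable {O : Type u} [CommRing O] [IsDomain O] [IsDiscreteValuationRing O]
  [Finite (ResidueField O)] [IsAdicComplete (maximalIdeal O) O]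

theorem gh_congr (ϖ : Uniformizer O) {b c : ℕ → O} {n : ℕ} (h : ∀ i ≤ n, ϖ.1 ∣ b i - c i) :
    ϖ.1 ^ (n + 1) ∣ gh ϖ b n - gh ϖ c n := by
  rw [gh, gh, ghost, ghost, ← Finset.sum_sub_distrib]
  refine Finset.dvd_sum fun i hi => ?_
  have hi : i ≤ n := Nat.lt_succ_iff.mp (Finset.mem_range.mp hi)
  rw [← mul_sub, show n + 1 = i + (n - i + 1) by omega, pow_add]
  exact mul_dvd_mul_left _ (pow_dvd_pow_sub_pow (dvd_card ϖ) (h i hi) _)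

theorem eq_of_forall_pow_dvd (ϖ : Uniformizer O) {x y : O} (h : ∀ n, ϖ.1 ^ n ∣ x - y) :
    x = y := by
  rw [← sub_eq_zero]
  refine IsHausdorff.haus (inferInstance : IsHausdorff (maximalIdeal O) O) _ fun n => ?_
  rw [SModEq.zero, smul_eq_mul, Ideal.mul_top, ϖ.2.maximalIdeal_eq, Ideal.span_singleton_pow,
    Ideal.mem_span_singleton]
  exact h n

theorem exists_limit (ϖ : Uniformizer O) (a : ℕ → O)
    (ha : ∀ n, ϖ.1 ^ (n + 1) ∣ a (n + 1) - a n) : ∃ x, ∀ n, ϖ.1 ^ (n + 1) ∣ x - a n := by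
  have hmem : ∀ (n : ℕ) (x y : O),
      x ≡ y [SMOD (maximalIdeal O ^ n • ⊤ : Submodule O O)] ↔ ϖ.1 ^ n ∣ x - y := by
    intro n x y
    rw [SModEq.sub_mem, smul_eq_mul, Ideal.mul_top, ϖ.2.maximalIdeal_eq,
      Ideal.span_singleton_pow, Ideal.mem_span_singleton]
  have hc : ∀ {m n}, m ≤ n → ϖ.1 ^ m ∣ a m - a n := by
    intro m n hmn
    induction n, hmn using Nat.le_induction with
    | base => simp
    | succ n hmn ih =>
      have := dvd_sub ih ((pow_dvd_pow ϖ.1 (show m ≤ n + 1 by omega)).trans (ha n))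
      rwa [sub_sub, add_sub_cancel] at this
  obtain ⟨x, hx⟩ := IsPrecomplete.prec (inferInstance : IsPrecomplete (maximalIdeal O) O)
    (f := a) fun hmn => (hmem _ _ _).mpr (hc hmn)
  refine ⟨x, fun n => ?_⟩
  have h1 := (hmem _ _ _).mp (hx (n + 1))
  have := dvd_sub (ha n) h1
  rw [sub_sub_sub_cancel_left] at this
  exact this

theorem bijective_algebraMap (ϖ : Uniformizer O) :
    Function.Bijective (algebraMap O (RWitt ϖ (ResidueField O))) := by
  have hgh : ∀ c n, gh ϖ (RWitt.scalar ϖ c).coeff n = c := RWitt.ghostFun_scalar ϖ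
  have hcoeff : ∀ c n, (algebraMap O (RWitt ϖ (ResidueField O)) c).coeff n =
      residue O ((RWitt.scalar ϖ c).coeff n) := fun c n => rfl
  constructor
  · intro c d hcd
    refine eq_of_forall_pow_dvd ϖ fun n => (pow_dvd_pow _ n.le_succ).trans ?_
    rw [← hgh c n, ← hgh d n]
    refine gh_congr ϖ fun i _ => ?_
    rw [uniformizer_dvd_sub_iff, ← hcoeff, ← hcoeff, hcd]
  · intro x
    choose b hb using fun n => residue_surjective (x.coeff n)
    obtain ⟨c, hc⟩ := exists_limit ϖ (gh ϖ b) fun n =>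
      pow_dvd_ghost_succ_sub (σ := RingHom.id O) rfl (dvd_card ϖ) (dvd_pow_card_sub ϖ) b n
    have key : ∀ n, ϖ.1 ∣ (RWitt.scalar ϖ c).coeff n - b n := by
      intro n
      induction n using Nat.strong_induction_on with
      | _ n ih =>
        have h1 := hc n
        rw [← hgh c n, gh, gh, ghost, ghost, Finset.sum_range_succ, Finset.sum_range_succ,
          add_sub_add_comm, ← Finset.sum_sub_distrib] at h1
        have h2 : ϖ.1 ^ (n + 1) ∣ ∑ i ∈ Finset.range n,
            (algebraMap O O ϖ.1 ^ i * (RWitt.scalar ϖ c).coeff i ^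
              Nat.card (ResidueField O) ^ (n - i) -
            algebraMap O O ϖ.1 ^ i * b i ^ Nat.card (ResidueField O) ^ (n - i)) := by
          refine Finset.dvd_sum fun i hi => ?_
          have hi := Finset.mem_range.mp hi
          rw [← mul_sub, show n + 1 = i + (n - i + 1) by omega, pow_add]
          exact mul_dvd_mul_left _ (pow_dvd_pow_sub_pow (dvd_card ϖ) (ih i hi) _)
        have h3 := (dvd_add_right h2).mp h1
        rw [Nat.sub_self, pow_zero, pow_one, pow_one, ← mul_sub, pow_succ] at h3
        exact (mul_dvd_mul_iff_left (pow_ne_zero n ϖ.2.ne_zero)).mp h3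
    refine ⟨c, RWitt.ext (funext fun n => ?_)⟩
    rw [hcoeff, ← hb, ← uniformizer_dvd_sub_iff ϖ]
    exact key n

variable (p : ℕ) [Fact p.Prime] [CharP (ResidueField O) p]

theorem exists_lift (ϖ : Uniformizer O) : ∃ f : WittVector p (ResidueField O) →+* O,
    (∀ x, residue O (f x) = x.coeff 0) ∧
      ∀ x, algebraMap O (RWitt ϖ (ResidueField O)) (f x) = RWitt.drinfeld p ϖ _ x := by
  let e := RingEquiv.ofBijective _ (bijective_algebraMap ϖ)
  have he : ∀ y, algebraMap O (RWitt ϖ (ResidueField O)) (e.symm y) = y :=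
    fun y => e.apply_symm_apply y
  refine ⟨(e.symm : _ →+* O).comp (RWitt.drinfeld p ϖ _), fun x => ?_, fun x => he _⟩
  have h0 : ∀ c, (algebraMap O (RWitt ϖ (ResidueField O)) c).coeff 0 = residue O c := by
    intro c
    have := RWitt.ghostFun_scalar ϖ c 0
    rw [RWitt.algebraMap_coeff]
    simp only [RWitt.ghostFun, gh, ghost] at this
    simp at this
    rw [this]
    rfl
  rw [← h0]
  refine Eq.trans ?_ (RWitt.drinfeld_coeff_zero p (ϖ := ϖ) x)
  exact congrArg (fun z => RWitt.coeff z 0) (he _)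

theorem lift_unique {f g : WittVector p (ResidueField O) →+* O}
    (hf : ∀ x, residue O (f x) = x.coeff 0) (hg : ∀ x, residue O (g x) = x.coeff 0) :
    f = g := by
  obtain ⟨ϖ, hϖ⟩ := IsDiscreteValuationRing.exists_irreducible O
  let ϖ' : Uniformizer O := ⟨ϖ, hϖ⟩
  have hT : ∀ c, f (WittVector.teichmuller p c) = g (WittVector.teichmuller p c) := by
    intro c
    refine eq_of_forall_pow_dvd ϖ' fun n => (pow_dvd_pow _ n.le_succ).trans ?_
    have hc : WittVector.teichmuller p c ^ Nat.card (ResidueField O) ^ n =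
        WittVector.teichmuller p c := by
      rw [← map_pow]
      congr 1
      induction n with
      | zero => simp
      | succ n ih => rw [pow_succ, pow_mul, ih, residue_pow_card]
    rw [← hc, map_pow, map_pow]
    refine pow_dvd_pow_sub_pow (dvd_card ϖ') ?_ n
    rw [uniformizer_dvd_sub_iff, hf, hg]
  ext x
  refine eq_of_forall_pow_dvd ϖ' fun n => ?_
  have hnil : IsNilpotent (p : O ⧸ Ideal.span {ϖ ^ n}) := by
    refine ⟨n, ?_⟩
    rw [← map_natCast (Ideal.Quotient.mk _), ← map_pow, Ideal.Quotient.eq_zero_iff_mem,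
      Ideal.mem_span_singleton]
    exact pow_dvd_pow_of_dvd (dvd_prime ϖ' p) n
  have := RingHom.congr_fun (WittVector.eq_of_apply_teichmuller_eq
    ((Ideal.Quotient.mk (Ideal.span {ϖ ^ n})).comp f)
    ((Ideal.Quotient.mk (Ideal.span {ϖ ^ n})).comp g) hnil fun c => by simp [hT c]) x
  rwa [RingHom.comp_apply, RingHom.comp_apply, Ideal.Quotient.eq, Ideal.mem_span_singleton]
    at this

end Base

end RamifiedWitt

section WittLift

open RamifiedWitt

variable (p : ℕ) [Fact p.Prime] (O : Type u) [CommRing O] [IsDomain O]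
  [IsDiscreteValuationRing O] [Finite (ResidueField O)] [IsAdicComplete (maximalIdeal O) O]
  [CharP (ResidueField O) p]

theorem existsUnique_wittLift :
    ∃! f : WittVector p (ResidueField O) →+* O, ∀ x, residue O (f x) = x.coeff 0 := by
  obtain ⟨ϖ, hϖ⟩ := IsDiscreteValuationRing.exists_irreducible O
  obtain ⟨f, hf, -⟩ := exists_lift p (⟨ϖ, hϖ⟩ : Uniformizer O)
  exact ⟨f, hf, fun g hg => lift_unique p hg hf⟩

/-- The unique ring homomorphism `W(k) → O` that induces the identity on residue fields. -/
def wittLift : WittVector p (ResidueField O) →+* O := (existsUnique_wittLift p O).choose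

theorem residue_wittLift (x : WittVector p (ResidueField O)) :
    residue O (wittLift p O x) = x.coeff 0 :=
  (existsUnique_wittLift p O).choose_spec.1 x

/-- `O` as an algebra over `W(k)`. -/
@[reducible]
def wittAlgebra : Algebra (WittVector p (ResidueField O)) O := (wittLift p O).toAlgebra

theorem algebraMap_wittLift (ϖ : Uniformizer O) (x : WittVector p (ResidueField O)) :
    algebraMap O (RWitt ϖ (ResidueField O)) (wittLift p O x) = RWitt.drinfeld p ϖ _ x := by
  obtain ⟨f, hf, hf2⟩ := exists_lift p ϖ
  rw [lift_unique p (residue_wittLift p O) hf, hf2]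

attribute [local instance] wittAlgebra

theorem wittLift_injective [CharZero O] : Function.Injective (wittLift p O) := by
  rw [injective_iff_map_eq_zero]
  intro a ha
  by_contra h0
  obtain ⟨m, b, hb⟩ := WittVector.exists_eq_pow_p_mul' a h0
  rw [hb, map_mul, map_pow, map_natCast] at ha
  have h1 : (p : O) ≠ 0 := Nat.cast_ne_zero.mpr (Fact.out : p.Prime).ne_zero
  exact ((b.isUnit.map (wittLift p O)).ne_zero) ((mul_eq_zero.mp ha).resolve_left (pow_ne_zero _ h1))

theorem smodEq_span_pow_iff {R M : Type*} [CommRing R] [AddCommGroup M] [Module R M] (a : R)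
    (n : ℕ) (x y : M) :
    x ≡ y [SMOD (Ideal.span {a} ^ n • ⊤ : Submodule R M)] ↔ ∃ z, a ^ n • z = x - y := by
  rw [SModEq.sub_mem, Ideal.span_singleton_pow, Submodule.ideal_span_singleton_smul]
  simp [Submodule.mem_smul_pointwise_iff_exists]

theorem isPrecomplete_pi {R ι : Type*} [CommRing R] (a : R)
    [IsPrecomplete (Ideal.span {a}) R] : IsPrecomplete (Ideal.span {a}) (ι → R) := by
  refine ⟨fun f hf => ?_⟩
  have h : ∀ i, ∃ L, ∀ n, f n i ≡ L [SMOD (Ideal.span {a} ^ n • ⊤ : Submodule R R)] := by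
    intro i
    refine IsPrecomplete.prec (inferInstance : IsPrecomplete (Ideal.span {a}) R)
      (f := fun n => f n i) fun {m n} hmn => ?_
    obtain ⟨z, hz⟩ := (smodEq_span_pow_iff a m _ _).mp (hf hmn)
    exact (smodEq_span_pow_iff a m _ _).mpr ⟨z i, congrFun hz i⟩
  choose L hL using h
  refine ⟨L, fun n => (smodEq_span_pow_iff a n _ _).mpr ?_⟩
  choose z hz using fun i => (smodEq_span_pow_iff a n _ _).mp (hL i n)
  exact ⟨z, funext hz⟩

theorem exists_digits (ϖ : Uniformizer O) (x : O) (j : ℕ) :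
    ∃ y : ℕ → WittVector p (ResidueField O),
      ϖ.1 ^ j ∣ x - ∑ i ∈ Finset.range j, wittLift p O (y i) * ϖ.1 ^ i := by
  induction j with
  | zero => simp
  | succ j ih =>
    obtain ⟨y, z, hz⟩ := ih
    let t := WittVector.teichmuller p (residue O z)
    have ht : ϖ.1 ∣ z - wittLift p O t := by
      rw [uniformizer_dvd_sub_iff, residue_wittLift, WittVector.teichmuller_coeff_zero]
    refine ⟨Function.update y j t, ?_⟩
    rw [Finset.sum_range_succ, Function.update_self, Finset.sum_congr rfl fun i hi => by
      rw [Function.update_of_ne (Finset.mem_range.mp hi).ne], ← sub_sub, hz, mul_comm, ← sub_mul,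
      mul_comm, pow_succ]
    exact mul_dvd_mul_left _ ht

theorem finite_wittAlgebra [CharZero O] : Module.Finite (WittVector p (ResidueField O)) O := by
  obtain ⟨π, hπ⟩ := IsDiscreteValuationRing.exists_irreducible O
  let ϖ : Uniformizer O := ⟨π, hπ⟩
  have h1 : (p : O) ≠ 0 := Nat.cast_ne_zero.mpr (Fact.out : p.Prime).ne_zero
  obtain ⟨e, he⟩ := IsDiscreteValuationRing.associated_pow_irreducible h1 hπ
  let f : (Fin e → WittVector p (ResidueField O)) →ₗ[WittVector p (ResidueField O)] O :=
    Fintype.linearCombination _ fun i : Fin e => π ^ (i : ℕ)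
  have hsmul : ∀ (a : WittVector p (ResidueField O)) (y : O), a • y = wittLift p O a * y :=
    fun a y => Algebra.smul_def a y
  have hf : ∀ y, f y = ∑ i : Fin e, wittLift p O (y i) * π ^ (i : ℕ) := fun y => by
    simp only [f, Fintype.linearCombination_apply, hsmul]
  have : IsPrecomplete (Ideal.span {(p : WittVector p (ResidueField O))})
      (Fin e → WittVector p (ResidueField O)) := isPrecomplete_pi _
  have : IsHausdorff (Ideal.span {(p : WittVector p (ResidueField O))}) O := by
    refine ⟨fun x hx => eq_of_forall_pow_dvd ϖ fun n => ?_⟩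
    obtain ⟨z, hz⟩ := (smodEq_span_pow_iff _ n _ _).mp (hx n)
    rw [hsmul, map_pow, map_natCast] at hz
    exact (pow_dvd_pow_of_dvd (dvd_prime ϖ p) n).trans ⟨z, hz.symm⟩
  refine Module.Finite.of_surjective f
    (surjective_of_mkQ_comp_surjective (I := Ideal.span {(p : WittVector p (ResidueField O))}) ?_)
  intro x
  obtain ⟨x, rfl⟩ := Submodule.mkQ_surjective _ x
  obtain ⟨y, hy⟩ := exists_digits p O ϖ x e
  obtain ⟨z, hz⟩ := he.dvd.trans hy
  refine ⟨fun i => y i, ?_⟩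
  have := (smodEq_span_pow_iff (p : WittVector p (ResidueField O)) 1 x (f fun i => y i)).mpr
    ⟨z, by rw [hsmul, pow_one, map_natCast, ← hz, hf, Fin.sum_univ_eq_sum_range
      (fun i => wittLift p O (y i) * π ^ i)]⟩
  rw [pow_one] at this
  exact this.symm

theorem free_wittAlgebra [CharZero O] : Module.Free (WittVector p (ResidueField O)) O := by
  have := finite_wittAlgebra p O
  have : FaithfulSMul (WittVector p (ResidueField O)) O :=
    (faithfulSMul_iff_algebraMap_injective _ _).mpr (wittLift_injective p O)
  infer_instance

end WittLift

/-! ### The Greenberg algebra, the ramified Witt vectors and the comparison, as functors -/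

section Comparison

variable (p : ℕ) [Fact p.Prime] {O : Type u} [CommRing O] [IsDomain O]
  [IsDiscreteValuationRing O] [Finite (ResidueField O)] [IsAdicComplete (maximalIdeal O) O]
  [CharP (ResidueField O) p] (ϖ : Uniformizer O)

attribute [local instance] wittAlgebra

/-- `W(A)` as an algebra over `W(k)`, for a `k`-algebra `A`. -/
@[reducible]
def wittMapAlgebra (k : Type u) (A : Type v) [CommRing k] [CommRing A] [Algebra k A] :
    Algebra (WittVector p k) (WittVector p A) :=
  (WittVector.map (algebraMap k A)).toAlgebra

attribute [local instance] wittMapAlgebra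

/-- The homomorphism `W(A) → W(B)` induced by a homomorphism of `k`-algebras `A → B`. -/
def wittMapAlgHom {k : Type u} {A B : Type v} [CommRing k] [CommRing A] [CommRing B]
    [Algebra k A] [Algebra k B] (f : A →ₐ[k] B) :
    WittVector p A →ₐ[WittVector p k] WittVector p B :=
  { WittVector.map (f : A →+* B) with
    commutes' := fun x => by
      refine WittVector.ext fun n => ?_
      change f (algebraMap k A (x.coeff n)) = algebraMap k B (x.coeff n)
      exact f.commutes _ }

/-- A `k`-algebra seen as an `O`-algebra. -/
@[reducible]
def residueAlgebra (A : Type v) [CommRing A] [Algebra (ResidueField O) A] : Algebra O A :=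
  Algebra.compHom A (residue O)

variable (O) in
/-- Restriction of scalars from `k`-algebras to `O`-algebras. -/
def residueRestrict : CommAlgCat.{u} (ResidueField O) ⥤ CommAlgCat.{u} O where
  obj A := letI := residueAlgebra (O := O) A; CommAlgCat.of O A
  map {A B} f :=
    letI := residueAlgebra (O := O) A
    letI := residueAlgebra (O := O) B
    CommAlgCat.ofHom (X := A) (Y := B)
      { (f.hom : A →+* B) with commutes' := fun c => f.hom.commutes (residue O c) }

variable (O) in
/-- The functor `A ↦ W(A) ⊗_{W(k)} O` from `k`-algebras to `O`-algebras. -/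
def greenbergFunctor : CommAlgCat.{u} (ResidueField O) ⥤ CommAlgCat.{u} O where
  obj A := CommAlgCat.of O (O ⊗[WittVector p (ResidueField O)] WittVector p A)
  map f := CommAlgCat.ofHom
    (Algebra.TensorProduct.map (AlgHom.id O O) (wittMapAlgHom p f.hom))
  map_id A := by
    rw [show wittMapAlgHom p (CommAlgCat.Hom.hom (𝟙 A)) = AlgHom.id _ _ from rfl,
      Algebra.TensorProduct.map_id]
    rfl
  map_comp f g := by
    rw [← CommAlgCat.ofHom_comp, ← Algebra.TensorProduct.map_comp]
    rfl

/-- The functor `B ↦ W_O(B)` from `O`-algebras to `O`-algebras. -/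
def rwittFunctor : CommAlgCat.{u} O ⥤ CommAlgCat.{u} O where
  obj B := CommAlgCat.of O (RWitt ϖ B)
  map f := CommAlgCat.ofHom
    { RWitt.map f.hom with commutes' := fun c => RWitt.map_algebraMap f.hom c }

/-- `W_O(A)` as an algebra over `W(k)`. -/
@[reducible]
def rwittAlgebra (A : Type v) [CommRing A] [Algebra O A] :
    Algebra (WittVector p (ResidueField O)) (RWitt ϖ A) :=
  Algebra.compHom (RWitt ϖ A) (wittLift p O)

attribute [local instance] rwittAlgebra

instance rwittTower (A : Type v) [CommRing A] [Algebra O A] :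
    IsScalarTower (WittVector p (ResidueField O)) O (RWitt ϖ A) :=
  IsScalarTower.of_algebraMap_eq fun _ => rfl

/-- The Drinfeld map `u : W(A) → W_O(A)` of a `k`-algebra `A` is a homomorphism of
`W(k)`-algebras. -/
def drinfeldAlgHom (A : Type v) [CommRing A] [Algebra (ResidueField O) A] [Algebra O A]
    [IsScalarTower O (ResidueField O) A] :
    WittVector p A →ₐ[WittVector p (ResidueField O)] RWitt ϖ A :=
  { RWitt.drinfeld p ϖ A with
    commutes' := fun x => by
      have h := RWitt.map_drinfeld p (ϖ := ϖ) (IsScalarTower.toAlgHom O (ResidueField O) A) x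
      rw [← algebraMap_wittLift, RWitt.map_algebraMap] at h
      exact h.symm }

/-- The comparison homomorphism `r_A = u ⊗ id : W(A) ⊗_{W(k)} O → W_O(A)` of `O`-algebras, for
a `k`-algebra `A`. -/
def comparisonAlgHom (A : Type v) [CommRing A] [Algebra (ResidueField O) A] [Algebra O A]
    [IsScalarTower O (ResidueField O) A] :
    O ⊗[WittVector p (ResidueField O)] WittVector p A →ₐ[O] RWitt ϖ A :=
  Algebra.TensorProduct.lift (Algebra.ofId O (RWitt ϖ A)) (drinfeldAlgHom p ϖ A)
    fun _ _ => Commute.all _ _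

theorem comparisonAlgHom_tmul (A : Type v) [CommRing A] [Algebra (ResidueField O) A]
    [Algebra O A] [IsScalarTower O (ResidueField O) A] (c : O) (x : WittVector p A) :
    comparisonAlgHom p ϖ A (c ⊗ₜ x) = algebraMap O (RWitt ϖ A) c * RWitt.drinfeld p ϖ A x :=
  Algebra.TensorProduct.lift_tmul _ _ _ _ _

theorem comparisonAlgHom_map {A B : Type v} [CommRing A] [Algebra (ResidueField O) A]
    [Algebra O A] [IsScalarTower O (ResidueField O) A] [CommRing B]
    [Algebra (ResidueField O) B] [Algebra O B] [IsScalarTower O (ResidueField O) B]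
    (f : A →ₐ[ResidueField O] B) (z : O ⊗[WittVector p (ResidueField O)] WittVector p A) :
    comparisonAlgHom p ϖ B (Algebra.TensorProduct.map (AlgHom.id O O) (wittMapAlgHom p f) z) =
      RWitt.map (f.restrictScalars O) (comparisonAlgHom p ϖ A z) := by
  induction z using TensorProduct.induction_on with
  | zero => simp only [map_zero]
  | add x y hx hy => simp only [map_add, hx, hy]
  | tmul c x =>
    rw [Algebra.TensorProduct.map_tmul, comparisonAlgHom_tmul, comparisonAlgHom_tmul, map_mul,
      RWitt.map_algebraMap, RWitt.map_drinfeld]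
    rfl

/-- The comparison homomorphisms `r_A`, as a natural transformation. -/
def comparison : greenbergFunctor p O ⟶ residueRestrict O ⋙ rwittFunctor ϖ where
  app A :=
    letI := residueAlgebra (O := O) A
    haveI : IsScalarTower O (ResidueField O) A := IsScalarTower.of_algebraMap_eq fun _ => rfl
    CommAlgCat.ofHom (comparisonAlgHom p ϖ A)
  naturality A B f := by
    let := residueAlgebra (O := O) A
    let := residueAlgebra (O := O) B
    have : IsScalarTower O (ResidueField O) A := IsScalarTower.of_algebraMap_eq fun _ => rfl
    have : IsScalarTower O (ResidueField O) B := IsScalarTower.of_algebraMap_eq fun _ => rfl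
    ext z
    exact comparisonAlgHom_map p ϖ f.hom z

/-! ### The representing schemes -/

/-- The restriction of `W_O` to `k`-algebras is represented by the polynomial ring
`k[X₀, X₁, ...]`, that is, by the special fiber of the scheme of ramified Witt vectors. -/
def rwittCorepresentableBy :
    ((residueRestrict O ⋙ rwittFunctor ϖ) ⋙ forget (CommAlgCat.{u} O)).CorepresentableBy
      (CommAlgCat.of (ResidueField O) (MvPolynomial ℕ (ResidueField O))) where
  homEquiv {A} :=
    { toFun := fun f => (⟨fun n => f.hom (MvPolynomial.X n)⟩ : RWitt ϖ A)
      invFun := fun x => CommAlgCat.ofHom (MvPolynomial.aeval (RWitt.coeff (B := A) x))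
      left_inv := fun f => by ext n; simp
      right_inv := fun x => RWitt.ext (funext fun n => by simp) }
  homEquiv_comp f g := rfl

variable [CharZero O]

variable (O) in
/-- The rank `e` of `O` over `W(k)`, which is the absolute ramification index of `O`. -/
def absRamification : ℕ := Module.finrank (WittVector p (ResidueField O)) O

variable (O) in
/-- A basis of `O` over `W(k)`. -/
def greenbergBasis : Module.Basis (Fin (absRamification p O)) (WittVector p (ResidueField O)) O :=
  haveI := finite_wittAlgebra p O
  haveI := free_wittAlgebra p O
  Module.finBasis (WittVector p (ResidueField O)) O

variable (O) in
/-- The coordinate ring of the Greenberg algebra: as a scheme, the Greenberg algebra is the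
product of `e` copies of the scheme of Witt vectors over `k`. -/
abbrev greenbergRing : Type u :=
  MvPolynomial (Fin (absRamification p O) × ℕ) (ResidueField O)

variable (O) in
/-- The coordinates of an element of `W(A) ⊗_{W(k)} O` in the chosen basis. -/
def greenbergCoord (A : Type v) [CommRing A] [Algebra (ResidueField O) A] :
    (Fin (absRamification p O) → WittVector p A) ≃
      O ⊗[WittVector p (ResidueField O)] WittVector p A :=
  Finsupp.equivFunOnFinite.symm.trans
    (TensorProduct.equivFinsuppOfBasisLeft (N := WittVector p A)
      (greenbergBasis p O)).symm.toEquiv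

theorem greenbergCoord_apply (A : Type v) [CommRing A] [Algebra (ResidueField O) A]
    (x : Fin (absRamification p O) → WittVector p A) :
    greenbergCoord p O A x = ∑ i, greenbergBasis p O i ⊗ₜ x i := by
  change (TensorProduct.equivFinsuppOfBasisLeft (greenbergBasis p O)).symm _ = _
  rw [TensorProduct.equivFinsuppOfBasisLeft_symm_apply, Finsupp.sum_fintype _ _ (by simp)]
  rfl

variable (O) in
/-- The points of the Greenberg algebra with values in a `k`-algebra `A` are the elements of
`W(A) ⊗_{W(k)} O`. -/
def greenbergPoints (A : Type v) [CommRing A] [Algebra (ResidueField O) A] :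
    (greenbergRing p O →ₐ[ResidueField O] A) ≃
      O ⊗[WittVector p (ResidueField O)] WittVector p A :=
  Equiv.trans
    { toFun := fun f i => WittVector.mk p fun n => f (MvPolynomial.X (i, n))
      invFun := fun x => MvPolynomial.aeval fun j => (x j.1).coeff j.2
      left_inv := fun f => by ext n; simp
      right_inv := fun x => funext fun i => WittVector.ext fun n => by simp }
    (greenbergCoord p O A)

theorem greenbergPoints_apply (A : Type v) [CommRing A] [Algebra (ResidueField O) A]
    (f : greenbergRing p O →ₐ[ResidueField O] A) :
    greenbergPoints p O A f = ∑ i, greenbergBasis p O i ⊗ₜ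
      (WittVector.mk p fun n => f (MvPolynomial.X (i, n)) : WittVector p A) :=
  greenbergCoord_apply p A _

theorem greenbergPoints_comp {A B : Type v} [CommRing A] [Algebra (ResidueField O) A]
    [CommRing B] [Algebra (ResidueField O) B] (f : A →ₐ[ResidueField O] B)
    (g : greenbergRing p O →ₐ[ResidueField O] A) :
    greenbergPoints p O B (f.comp g) =
      Algebra.TensorProduct.map (AlgHom.id O O) (wittMapAlgHom p f) (greenbergPoints p O A g) := by
  rw [greenbergPoints_apply, greenbergPoints_apply, map_sum]
  refine Finset.sum_congr rfl fun i _ => ?_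
  rw [Algebra.TensorProduct.map_tmul]
  rfl

variable (O) in
/-- The functor `A ↦ W(A) ⊗_{W(k)} O` is represented by the Greenberg algebra. -/
def greenbergCorepresentableBy :
    (greenbergFunctor p O ⋙ forget (CommAlgCat.{u} O)).CorepresentableBy
      (CommAlgCat.of (ResidueField O) (greenbergRing p O)) where
  homEquiv {A} :=
    { toFun := fun f => greenbergPoints p O A f.hom
      invFun := fun x => CommAlgCat.ofHom ((greenbergPoints p O A).symm x)
      left_inv := fun f => congrArg CommAlgCat.ofHom ((greenbergPoints p O A).symm_apply_apply f.hom)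
      right_inv := fun x => (greenbergPoints p O A).apply_symm_apply x }
  homEquiv_comp f g := greenbergPoints_comp p f.hom g.hom

variable (O) in
/-- The Greenberg algebra `ℝ_O`, as a scheme. -/
def greenbergScheme : Scheme.{u} := Spec (CommRingCat.of (greenbergRing p O))

variable (O) in
/-- The special fiber `𝕎_{O,k}` of the scheme of ramified Witt vectors. -/
def rwittSpecialFiber : Scheme.{u} := Spec (CommRingCat.of (MvPolynomial ℕ (ResidueField O)))

/-- The homomorphism of coordinate rings that corresponds to `comparison` under the Yoneda
lemma. -/
def comparisonCoord :
    CommAlgCat.of (ResidueField O) (MvPolynomial ℕ (ResidueField O)) ⟶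
      CommAlgCat.of (ResidueField O) (greenbergRing p O) :=
  (rwittCorepresentableBy ϖ).homEquiv.symm
    ((Functor.whiskerRight (comparison p ϖ) (forget (CommAlgCat.{u} O))).app _
      ((greenbergCorepresentableBy p O).homEquiv (𝟙 _)))

/-- On points, `comparisonCoord` induces the homomorphisms `r_A`. -/
theorem comparisonCoord_points (A : CommAlgCat.{u} (ResidueField O))
    (f : CommAlgCat.of (ResidueField O) (greenbergRing p O) ⟶ A) :
    (rwittCorepresentableBy ϖ).homEquiv (comparisonCoord p ϖ ≫ f) =
      (comparison p ϖ).app A ((greenbergCorepresentableBy p O).homEquiv f) := by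
  rw [(rwittCorepresentableBy ϖ).homEquiv_comp, comparisonCoord, Equiv.apply_symm_apply]
  have h := (greenbergCorepresentableBy p O).homEquiv_comp f (𝟙 _)
  rw [Category.id_comp] at h
  rw [h]
  exact (NatTrans.naturality_apply
    (Functor.whiskerRight (comparison p ϖ) (forget (CommAlgCat.{u} O))) f _).symm

/-- The homomorphism `r^*` on global sections. -/
def comparisonRingHom : CommRingCat.of (MvPolynomial ℕ (ResidueField O)) ⟶
    CommRingCat.of (greenbergRing p O) :=
  CommRingCat.ofHom (comparisonCoord p ϖ).hom.toRingHom

/-- The comparison morphism `r : ℝ_O → 𝕎_{O,k}`. -/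
def comparisonMorphism : greenbergScheme p O ⟶ rwittSpecialFiber O :=
  Spec.map (comparisonRingHom p ϖ)

/-- The kernel of `r`, as the group functor `A ↦ ker r_A` on `k`-algebras. -/
def comparisonKernel : CommAlgCat.{u} (ResidueField O) ⥤ AddCommGrpCat.{u} where
  obj A := AddCommGrpCat.of (RingHom.ker ((comparison p ϖ).app A).hom)
  map {A B} f := AddCommGrpCat.ofHom
    { toFun := fun x => ⟨((greenbergFunctor p O).map f).hom x.1, by
        have h := NatTrans.naturality_apply (comparison p ϖ) f x.1
        have hx : ((comparison p ϖ).app A).hom x.1 = 0 := x.2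
        refine h.trans ?_
        exact (congrArg ((residueRestrict O ⋙ rwittFunctor ϖ).map f).hom hx).trans (map_zero _)⟩
      map_zero' := Subtype.ext (map_zero ((greenbergFunctor p O).map f).hom)
      map_add' := fun x y => Subtype.ext (map_add ((greenbergFunctor p O).map f).hom x.1 y.1) }
  map_id A := by
    ext x
    change ((greenbergFunctor p O).map (𝟙 A)).hom x.1 = x.1
    rw [(greenbergFunctor p O).map_id]
    rfl
  map_comp f g := by
    ext x
    change ((greenbergFunctor p O).map (f ≫ g)).hom x.1 = _
    rw [(greenbergFunctor p O).map_comp]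
    rfl

end Comparison

/-- The scheme `Spec k[X₀, X₁, ...]` is the special fiber of `Spec O[X₀, X₁, ...]`. -/
theorem isPullback_rwittSpecialFiber (O : Type u) [CommRing O] [IsLocalRing O] :
    IsPullback
    (Spec.map (CommRingCat.ofHom (MvPolynomial.map (σ := ℕ) (residue O))))
    (Spec.map (CommRingCat.ofHom
      (algebraMap (ResidueField O) (MvPolynomial ℕ (ResidueField O)))))
    (Spec.map (CommRingCat.ofHom (algebraMap O (MvPolynomial ℕ O))))
    (Spec.map (CommRingCat.ofHom (residue O))) := by
  apply isPullback_SpecMap_of_isPushout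
  let := MvPolynomial.algebraMvPolynomial (σ := ℕ) (R := O) (S := ResidueField O)
  exact CommRingCat.isPushout_of_isPushout O (MvPolynomial ℕ O) (ResidueField O)
    (MvPolynomial ℕ (ResidueField O))

/-! ### Perfection, universal homeomorphisms, pro-infinitesimal groups -/

/-- The inverse system of copies of `Spec S` with the absolute Frobenius as transition maps. -/
def frobeniusTower (p : ℕ) [Fact p.Prime] (S : CommRingCat.{u}) [CharP S p] :
    ℕᵒᵖ ⥤ Scheme.{u} :=
  (Functor.ofSequence (X := fun _ => S)
    fun _ => CommRingCat.ofHom (frobenius S p)).op ⋙ Scheme.Spec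

instance (p : ℕ) [Fact p.Prime] (S : CommRingCat.{u}) [CharP S p] :
    HasLimit (frobeniusTower p S) := by
  unfold frobeniusTower
  infer_instance

/-- The inverse perfection `X^pf` of `X = Spec S`: the limit of the copies of `X` along the
absolute Frobenius. -/
def perfection (p : ℕ) [Fact p.Prime] (S : CommRingCat.{u}) [CharP S p] : Scheme.{u} :=
  limit (frobeniusTower p S)

/-- The morphism induced on the Frobenius towers by `Spec T → Spec S`. -/
def frobeniusTowerMap (p : ℕ) [Fact p.Prime] {S T : CommRingCat.{u}} [CharP S p] [CharP T p]
    (f : S ⟶ T) : frobeniusTower p T ⟶ frobeniusTower p S :=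
  Functor.whiskerRight (NatTrans.op (NatTrans.ofSequence
    (F := Functor.ofSequence (X := fun _ => S) fun _ => CommRingCat.ofHom (frobenius S p))
    (G := Functor.ofSequence (X := fun _ => T) fun _ => CommRingCat.ofHom (frobenius T p))
    (fun _ => f) fun n => by
      rw [Functor.ofSequence_map_homOfLE_succ, Functor.ofSequence_map_homOfLE_succ]
      ext x
      exact map_pow f.hom x p)) Scheme.Spec

/-- The morphism `X^pf → Y^pf` induced on perfections by a morphism `X = Spec T → Y = Spec S`. -/
def perfectionMap (p : ℕ) [Fact p.Prime] {S T : CommRingCat.{u}} [CharP S p] [CharP T p]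
    (f : S ⟶ T) : perfection p T ⟶ perfection p S :=
  limMap (frobeniusTowerMap p f)

/-- A universal homeomorphism: every base change is a homeomorphism. -/
def IsUniversalHomeomorphism : MorphismProperty Scheme.{u} :=
  (topologically @IsHomeomorph).universally

/-- A commutative `k`-group (as a functor on `k`-algebras) is infinitesimal if it is represented
by a finite local `k`-scheme. -/
def IsInfinitesimal {k : Type u} [Field k] (G : CommAlgCat.{u} k ⥤ AddCommGrpCat.{u}) : Prop :=
  ∃ H : CommAlgCat.{u} k, Nonempty ((G ⋙ forget AddCommGrpCat).CorepresentableBy H) ∧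
    Module.Finite k H ∧ IsLocalRing H

/-- A commutative `k`-group is pro-infinitesimal if it is a cofiltered limit of infinitesimal
`k`-groups. -/
def IsProInfinitesimal {k : Type u} [Field k] (G : CommAlgCat.{u} k ⥤ AddCommGrpCat.{u}) : Prop :=
  ∃ (J : Type u) (_ : SmallCategory J) (_ : IsCofiltered J)
    (F : J ⥤ CommAlgCat.{u} k ⥤ AddCommGrpCat.{u}) (c : Cone F),
    Nonempty (IsLimit c) ∧ Nonempty (c.pt ≅ G) ∧ ∀ j, IsInfinitesimal (F.obj j)

end

/-!
Over a perfect `k`-algebra `A` the homomorphism `r_A` is bijective: its source is `π`-adically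
complete, its target is `π`-adically separated and `π`-torsion free (multiplication by `π` shifts
the `q`-th powers of the components), and modulo `π` both sides are `A`. Testing this on perfect
closures shows that the homomorphism `r^*` of coordinate rings is `p`-radical: every element of its
kernel is nilpotent, and every element of its target has a `p^n`-th power in the image. This yields
the isomorphism of perfections and the universal homeomorphism. It also shows that every element of
the coordinate ring of `ker r` is a constant plus a nilpotent, so that the schematic images of
`ker r` in the groups of truncated Witt vectors are infinitesimal; `ker r` is their limit.
-/

section AdicTopology

variable {R M N : Type*} [CommRing R] [AddCommGroup M] [Module R M] [AddCommGroup N] [Module R N]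

theorem isHausdorff_pi {ι : Type*} (a : R) [IsHausdorff (Ideal.span {a}) R] :
    IsHausdorff (Ideal.span {a}) (ι → R) where
  haus' x hx := funext fun i =>
    IsHausdorff.haus' (I := Ideal.span {a}) _ fun n => by
      obtain ⟨z, hz⟩ := (smodEq_span_pow_iff a n x 0).mp (hx n)
      exact (smodEq_span_pow_iff a n (x i) 0).mpr ⟨z i, congrFun hz i⟩

theorem isAdicComplete_pi {ι : Type*} (a : R) [IsAdicComplete (Ideal.span {a}) R] :
    IsAdicComplete (Ideal.span {a}) (ι → R) where
  toIsHausdorff := isHausdorff_pi a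
  toIsPrecomplete := isPrecomplete_pi a

theorem isAdicComplete_of_pow {I : Ideal R} {e : ℕ} (he : e ≠ 0) [IsAdicComplete (I ^ e) M] :
    IsAdicComplete I M where
  haus' x hx := IsHausdorff.haus' (I := I ^ e) x fun n => by
    simpa only [← pow_mul] using hx (e * n)
  prec' f hf := by
    obtain ⟨L, hL⟩ := IsPrecomplete.prec' (I := I ^ e) (fun n => f (e * n)) fun {m n} hmn => by
        simpa only [← pow_mul] using hf (Nat.mul_le_mul_left e hmn)
    refine ⟨L, fun n => ?_⟩
    have hn : n ≤ e * n := Nat.le_mul_of_pos_left n (Nat.pos_of_ne_zero he)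
    refine (hf hn).trans (SModEq.mono (Submodule.smul_mono_left (Ideal.pow_le_pow_right hn)) ?_)
    simpa only [← pow_mul] using hL n

section Transfer

variable {S M' : Type*} [CommRing S] [AddCommGroup M'] [Module S M'] {a : R} {b : S}
  (σ : M ≃+ M') (hσ : ∀ x, σ (a • x) = b • σ x)

include hσ

theorem smodEq_span_pow_addEquiv_iff (n : ℕ) (x y : M) :
    σ x ≡ σ y [SMOD (Ideal.span {b} ^ n • ⊤ : Submodule S M')] ↔
      x ≡ y [SMOD (Ideal.span {a} ^ n • ⊤ : Submodule R M)] := by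
  have hpow : ∀ z, σ (a ^ n • z) = b ^ n • σ z := fun z => by
    induction n with
    | zero => simp only [pow_zero, one_smul]
    | succ n ih => rw [pow_succ', mul_smul, hσ, ih, pow_succ', mul_smul]
  rw [smodEq_span_pow_iff, smodEq_span_pow_iff, σ.surjective.exists]
  simp only [← hpow, ← map_sub, σ.injective.eq_iff]

theorem isAdicComplete_of_addEquiv [IsAdicComplete (Ideal.span {a}) M] :
    IsAdicComplete (Ideal.span {b}) M' where
  haus' x hx := by
    obtain ⟨x, rfl⟩ := σ.surjective x
    rw [IsHausdorff.haus' (I := Ideal.span {a}) x fun n => ?_, map_zero]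
    rw [← smodEq_span_pow_addEquiv_iff σ hσ, map_zero]
    exact hx n
  prec' f hf := by
    obtain ⟨L, hL⟩ := IsPrecomplete.prec' (I := Ideal.span {a}) (fun n => σ.symm (f n))
      fun {m n} hmn => by
        simpa only [← smodEq_span_pow_addEquiv_iff σ hσ, σ.apply_symm_apply] using hf hmn
    refine ⟨σ L, fun n => ?_⟩
    simpa only [← smodEq_span_pow_addEquiv_iff σ hσ, σ.apply_symm_apply] using hL n

end Transfer

theorem injective_of_isHausdorff_of_torsionFree {a : R} [IsHausdorff (Ideal.span {a}) M]
    (hN : ∀ y : N, a • y = 0 → y = 0) (f : M →ₗ[R] N) (h : ∀ x, f x = 0 → ∃ y, a • y = x) :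
    Function.Injective f := by
  rw [injective_iff_map_eq_zero]
  intro x hx
  have key : ∀ n, ∃ y, a ^ n • y = x ∧ f y = 0 := by
    intro n
    induction n with
    | zero => exact ⟨x, by rw [pow_zero, one_smul], hx⟩
    | succ n ih =>
      obtain ⟨y, hyx, hy⟩ := ih
      obtain ⟨z, rfl⟩ := h y hy
      exact ⟨z, by rw [pow_succ, mul_smul, hyx], hN _ (by rw [← map_smul, hy])⟩
  refine IsHausdorff.haus' (I := Ideal.span {a}) x fun n => ?_
  obtain ⟨y, hy, -⟩ := key n
  exact (smodEq_span_pow_iff a n x 0).mpr ⟨y, by rw [hy, sub_zero]⟩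

theorem surjective_of_isPrecomplete_of_isHausdorff {a : R} [IsPrecomplete (Ideal.span {a}) M]
    [IsHausdorff (Ideal.span {a}) N] (f : M →ₗ[R] N) (h : ∀ y, ∃ x z, a • z = y - f x) :
    Function.Surjective f := by
  refine surjective_of_mkQ_comp_surjective (I := Ideal.span {a}) fun y => ?_
  obtain ⟨y, rfl⟩ := Submodule.mkQ_surjective _ y
  obtain ⟨x, z, hz⟩ := h y
  have hxy := (smodEq_span_pow_iff a 1 y (f x)).mpr ⟨z, by rw [pow_one, hz]⟩
  rw [pow_one] at hxy
  exact ⟨x, hxy.symm⟩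

end AdicTopology

namespace RamifiedWitt

variable {B : Type v} [CommRing B]

/-- The shift of a sequence, with its terms raised to the power `q`. Modulo `w` this is
multiplication by `w` on ramified Witt vectors. -/
def shiftPow (q : ℕ) (b : ℕ → B) : ℕ → B
  | 0 => 0
  | n + 1 => b n ^ q

theorem ghost_shiftPow {q : ℕ} (hq : q ≠ 0) (w : B) (b : ℕ → B) (n : ℕ) :
    ghost w q (shiftPow q b) n + w ^ (n + 1) * b n = w * ghost w q b n := by
  have hi : ∀ i ∈ Finset.range n, w ^ (i + 1) * shiftPow q b (i + 1) ^ q ^ (n - (i + 1)) =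
      w * (w ^ i * b i ^ q ^ (n - i)) := fun i hi => by
    rw [shiftPow, ← pow_mul, ← pow_succ', pow_succ', mul_assoc,
      show n - (i + 1) + 1 = n - i by have := Finset.mem_range.mp hi; lia]
  rw [ghost, ghost, Finset.sum_range_succ', Finset.sum_congr rfl hi, Finset.sum_range_succ,
    ← Finset.mul_sum, mul_add, shiftPow, zero_pow (pow_ne_zero _ hq), mul_zero, add_zero,
    Nat.sub_self, pow_zero, pow_one, pow_succ', mul_assoc]

theorem dvd_sub_of_pow_dvd_ghost_sub {w : B} (hw : w ∈ nonZeroDivisors B)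
    {q : ℕ} (hq : w ∣ (q : B)) {b c : ℕ → B}
    (h : ∀ n, w ^ (n + 1) ∣ ghost w q b n - ghost w q c n) (n : ℕ) : w ∣ b n - c n := by
  induction n using Nat.strong_induction_on with
  | _ n ih =>
    have hlower : w ^ (n + 1) ∣ ∑ i ∈ Finset.range n,
        (w ^ i * b i ^ q ^ (n - i) - w ^ i * c i ^ q ^ (n - i)) := by
      refine Finset.dvd_sum fun i hi => ?_
      have hi := Finset.mem_range.mp hi
      rw [← mul_sub, show n + 1 = i + (n - i + 1) by lia, pow_add]
      exact mul_dvd_mul_left _ (pow_dvd_pow_sub_pow hq (ih i hi) _)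
    have htop := h n
    rw [ghost, ghost, Finset.sum_range_succ, Finset.sum_range_succ, add_sub_add_comm,
      ← Finset.sum_sub_distrib] at htop
    obtain ⟨d, hd⟩ := (dvd_add_right hlower).mp htop
    rw [Nat.sub_self, pow_zero, pow_one, pow_one, ← mul_sub, pow_succ, mul_assoc] at hd
    exact ⟨d, (mul_cancel_left_mem_nonZeroDivisors (pow_mem hw n)).mp hd⟩

theorem algebraMap_uniformizer_eq_zero {O : Type*} [CommRing O] [IsDomain O]
    [IsDiscreteValuationRing O] [Finite (ResidueField O)] (ϖ : Uniformizer O) (A : Type*)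
    [CommRing A] [Algebra (ResidueField O) A] [Algebra O A]
    [IsScalarTower O (ResidueField O) A] : algebraMap O A ϖ.1 = 0 := by
  rw [IsScalarTower.algebraMap_apply O (ResidueField O) A, ResidueField.algebraMap_eq,
    (uniformizer_dvd_iff ϖ ϖ.1).mp dvd_rfl, map_zero]

theorem bijective_pow_card (p : ℕ) [Fact p.Prime] (O : Type*) [CommRing O] [IsDomain O]
    [IsDiscreteValuationRing O] [Finite (ResidueField O)] [CharP (ResidueField O) p]
    (B : Type*) [CommRing B] [CharP B p] [PerfectRing B p] :
    Function.Bijective fun b : B => b ^ Nat.card (ResidueField O) := by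
  rw [(card_pos_exponent (O := O) p).1]
  exact bijective_iterateFrobenius B p _

end RamifiedWitt

namespace RWitt

open RamifiedWitt

variable {O : Type u} [CommRing O] [IsDomain O] [IsDiscreteValuationRing O]
  {ϖ : Uniformizer O} {B : Type v} [CommRing B] [Algebra O B]

theorem ghostFun_apply_zero (x : RWitt ϖ B) : ghostFun x 0 = x.coeff 0 := by
  simp [ghostFun, gh, ghost]

variable [Finite (ResidueField O)]

theorem ghostFun_algebraMap (c : O) (n : ℕ) :
    ghostFun (algebraMap O (RWitt ϖ B) c) n = algebraMap O B c :=
  (gh_map ϖ (Algebra.ofId O B) (scalar ϖ c).coeff n).symm.trans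
    (congrArg (algebraMap O B) (ghostFun_scalar ϖ c n))

variable (ϖ B) in
/-- The projection of `W_O(B)` to the component of index `0`, which is a ring homomorphism since
this component is the first ghost component. -/
@[simps]
def coeffZero : RWitt ϖ B →+* B where
  toFun x := x.coeff 0
  map_zero' := rfl
  map_one' := rfl
  map_add' x y := by simpa only [ghostFun_apply_zero] using ghostFun_add x y 0
  map_mul' x y := by simpa only [ghostFun_apply_zero] using ghostFun_mul x y 0

theorem coeff_zero_smul (c : O) (x : RWitt ϖ B) :
    (c • x).coeff 0 = algebraMap O B c * x.coeff 0 := by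
  rw [← ghostFun_apply_zero, Algebra.smul_def, ghostFun_mul, ghostFun_algebraMap,
    ghostFun_apply_zero]

theorem dvd_coeff_uniformizer_smul_sub {I : Type*} (x : RWitt ϖ (MvPolynomial I O)) (n : ℕ) :
    algebraMap O (MvPolynomial I O) ϖ.1 ∣
      (ϖ.1 • x).coeff n - shiftPow (Nat.card (ResidueField O)) x.coeff n := by
  refine dvd_sub_of_pow_dvd_ghost_sub (algebraMap_uniformizer_mem ϖ I)
    (by simpa only [map_natCast] using map_dvd (algebraMap O (MvPolynomial I O)) (dvd_card ϖ))
    (fun n => ⟨x.coeff n, ?_⟩) n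
  have hmul : gh ϖ (ϖ.1 • x).coeff n = algebraMap O _ ϖ.1 * gh ϖ x.coeff n := by
    have := ghostFun_mul (algebraMap O _ ϖ.1) x n
    rwa [ghostFun_algebraMap, ← Algebra.smul_def] at this
  rw [sub_eq_iff_eq_add', ghost_shiftPow Nat.card_pos.ne']
  exact hmul

theorem coeff_uniformizer_smul (hB : algebraMap O B ϖ.1 = 0) (x : RWitt ϖ B) :
    (ϖ.1 • x).coeff = shiftPow (Nat.card (ResidueField O)) x.coeff := by
  funext n
  obtain ⟨y, rfl⟩ := exists_mapFun_cover x
  have hmap : ϖ.1 • mapFun (cover O B) y = map (cover O B) (ϖ.1 • y) := by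
    rw [Algebra.smul_def, Algebra.smul_def, map_mul, map_algebraMap]
    rfl
  obtain ⟨d, hd⟩ := dvd_coeff_uniformizer_smul_sub y n
  rw [sub_eq_iff_eq_add] at hd
  rw [hmap, map_coeff, hd, map_add, map_mul, AlgHom.commutes, hB, zero_mul, zero_add]
  cases n with
  | zero => exact map_zero _
  | succ n => exact map_pow _ _ _

theorem coeff_uniformizer_pow_smul (hB : algebraMap O B ϖ.1 = 0) (m : ℕ) (x : RWitt ϖ B) {n : ℕ}
    (hn : n < m) : (ϖ.1 ^ m • x).coeff n = 0 := by
  induction m generalizing n with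
  | zero => lia
  | succ m ih =>
    rw [pow_succ', mul_smul, coeff_uniformizer_smul hB]
    cases n with
    | zero => rfl
    | succ n => rw [shiftPow, ih (by lia), zero_pow Nat.card_pos.ne']

theorem isHausdorff_span_uniformizer (hB : algebraMap O B ϖ.1 = 0) :
    IsHausdorff (Ideal.span {ϖ.1}) (RWitt ϖ B) where
  haus' x hx := RWitt.ext <| funext fun n => by
    obtain ⟨z, hz⟩ := (smodEq_span_pow_iff ϖ.1 (n + 1) x 0).mp (hx (n + 1))
    rw [sub_zero] at hz
    rw [← hz]
    exact coeff_uniformizer_pow_smul hB (n + 1) z n.lt_succ_self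

section Perfect

variable (p : ℕ) [Fact p.Prime] [CharP (ResidueField O) p] [CharP B p] [PerfectRing B p]

include p

theorem eq_zero_of_uniformizer_smul_eq_zero (hB : algebraMap O B ϖ.1 = 0) {x : RWitt ϖ B}
    (h : ϖ.1 • x = 0) : x = 0 :=
  RWitt.ext <| funext fun n => (bijective_pow_card p O B).1 <| by
    have hn := congrFun (coeff_uniformizer_smul hB x) (n + 1)
    rw [h, shiftPow] at hn
    exact hn.symm.trans (zero_pow Nat.card_pos.ne').symm

theorem exists_uniformizer_smul_eq (hB : algebraMap O B ϖ.1 = 0) {x : RWitt ϖ B}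
    (h : x.coeff 0 = 0) : ∃ y, ϖ.1 • y = x := by
  choose y hy using fun n => (bijective_pow_card p O B).2 (x.coeff (n + 1))
  refine ⟨⟨y⟩, RWitt.ext ?_⟩
  rw [coeff_uniformizer_smul hB]
  funext n
  cases n with
  | zero => exact h.symm
  | succ n => exact hy n

end Perfect

end RWitt
section PerfectComparison

open RamifiedWitt

attribute [local instance] wittAlgebra wittMapAlgebra rwittAlgebra

variable (p : ℕ) [Fact p.Prime] {O : Type u} [CommRing O] [IsDomain O]
  [IsDiscreteValuationRing O] [Finite (ResidueField O)] [IsAdicComplete (maximalIdeal O) O]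
  [CharP (ResidueField O) p] (ϖ : Uniformizer O)

section Greenberg

variable {A : Type v} [CommRing A] [Algebra (ResidueField O) A]

theorem exists_uniformizer_smul_eq_sub_tmul
    (z : O ⊗[WittVector p (ResidueField O)] WittVector p A) :
    ∃ (x : WittVector p A) (y : O ⊗[WittVector p (ResidueField O)] WittVector p A),
      ϖ.1 • y = z - 1 ⊗ₜ x := by
  induction z using TensorProduct.induction_on with
  | zero => exact ⟨0, 0, by rw [smul_zero, TensorProduct.tmul_zero, sub_zero]⟩
  | add a b ha hb =>
    obtain ⟨x, y, hy⟩ := ha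
    obtain ⟨x', y', hy'⟩ := hb
    exact ⟨x + x', y + y', by rw [smul_add, hy, hy', TensorProduct.tmul_add, add_sub_add_comm]⟩
  | tmul c x =>
    let t := WittVector.teichmuller p (residue O c)
    obtain ⟨d, hd⟩ : ϖ.1 ∣ c - wittLift p O t := by
      rw [uniformizer_dvd_sub_iff, residue_wittLift,
        WittVector.teichmuller_coeff_zero]
    refine ⟨t • x, d ⊗ₜ x, ?_⟩
    rw [TensorProduct.smul_tmul', smul_eq_mul, ← hd, TensorProduct.sub_tmul,
      ← TensorProduct.smul_tmul, Algebra.smul_def, mul_one]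
    rfl

variable (O A) in
/-- The coordinates of the Greenberg algebra as an isomorphism of additive groups. -/
noncomputable def greenbergCoordAddEquiv [CharZero O] :
    (Fin (absRamification p O) → WittVector p A) ≃+
      O ⊗[WittVector p (ResidueField O)] WittVector p A where
  toEquiv := greenbergCoord p O A
  map_add' x y := by
    change greenbergCoord p O A (x + y) = greenbergCoord p O A x + greenbergCoord p O A y
    simp only [greenbergCoord_apply, Pi.add_apply, TensorProduct.tmul_add, Finset.sum_add_distrib]

theorem isAdicComplete_span_uniformizer_tensorProduct [CharZero O] [CharP A p] [PerfectRing A p] :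
    IsAdicComplete (Ideal.span {ϖ.1}) (O ⊗[WittVector p (ResidueField O)] WittVector p A) := by
  have hp0 : (p : O) ≠ 0 := Nat.cast_ne_zero.mpr (Fact.out : p.Prime).ne_zero
  obtain ⟨e, he⟩ := IsDiscreteValuationRing.associated_pow_irreducible hp0 ϖ.2
  have he0 : e ≠ 0 := by
    rintro rfl
    rw [pow_zero, associated_one_iff_isUnit] at he
    exact ϖ.2.not_isUnit (isUnit_of_dvd_unit (dvd_prime ϖ p) he)
  have := isAdicComplete_pi (ι := Fin (absRamification p O)) (p : WittVector p A)
  have hp : IsAdicComplete (Ideal.span {(p : O)})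
      (O ⊗[WittVector p (ResidueField O)] WittVector p A) :=
    isAdicComplete_of_addEquiv (a := (p : WittVector p A)) (greenbergCoordAddEquiv p O A)
      fun x => by rw [Nat.cast_smul_eq_nsmul, Nat.cast_smul_eq_nsmul, map_nsmul]
  rw [Ideal.span_singleton_eq_span_singleton.mpr he, ← Ideal.span_singleton_pow] at hp
  exact isAdicComplete_of_pow he0

end Greenberg

variable (A : Type v) [CommRing A] [Algebra (ResidueField O) A] [Algebra O A]
  [IsScalarTower O (ResidueField O) A]

theorem coeff_zero_comparisonAlgHom {z y : O ⊗[WittVector p (ResidueField O)] WittVector p A}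
    {x : WittVector p A} (h : ϖ.1 • y = z - 1 ⊗ₜ x) :
    (comparisonAlgHom p ϖ A z).coeff 0 = x.coeff 0 := by
  rw [eq_add_of_sub_eq h.symm, map_add, map_smul, comparisonAlgHom_tmul, map_one, one_mul,
    ← RWitt.coeffZero_apply, map_add, RWitt.coeffZero_apply, RWitt.coeffZero_apply,
    RWitt.coeff_zero_smul, algebraMap_uniformizer_eq_zero, zero_mul, zero_add,
    RWitt.drinfeld_coeff_zero]

variable [CharP A p] [PerfectRing A p]

theorem exists_uniformizer_smul_eq_of_comparisonAlgHom_eq_zero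
    {z : O ⊗[WittVector p (ResidueField O)] WittVector p A} (hz : comparisonAlgHom p ϖ A z = 0) :
    ∃ y, ϖ.1 • y = z := by
  obtain ⟨x, y, hy⟩ := exists_uniformizer_smul_eq_sub_tmul p ϖ z
  have hx : x.coeff 0 = 0 := by
    rw [← coeff_zero_comparisonAlgHom p ϖ A hy, hz]
    rfl
  obtain ⟨w, rfl⟩ := Ideal.mem_span_singleton.mp
    (WittVector.mem_span_p_iff_coeff_zero_eq_zero x |>.mpr hx)
  obtain ⟨d, hd⟩ := dvd_prime ϖ p
  have hpw : (1 : O) ⊗ₜ[WittVector p (ResidueField O)] ((p : WittVector p A) * w) =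
      ϖ.1 • d ⊗ₜ w := by
    rw [TensorProduct.smul_tmul', smul_eq_mul, ← hd, ← nsmul_eq_mul, TensorProduct.tmul_smul,
      TensorProduct.smul_tmul', nsmul_one]
  exact ⟨y + d ⊗ₜ w, by rw [smul_add, hy, ← hpw, sub_add_cancel]⟩

theorem bijective_comparisonAlgHom [CharZero O] :
    Function.Bijective (comparisonAlgHom p ϖ A) := by
  have hϖ := algebraMap_uniformizer_eq_zero ϖ A
  have := isAdicComplete_span_uniformizer_tensorProduct p ϖ (A := A)
  have := RWitt.isHausdorff_span_uniformizer hϖ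
  refine ⟨injective_of_isHausdorff_of_torsionFree
      (fun _ => RWitt.eq_zero_of_uniformizer_smul_eq_zero p hϖ) (comparisonAlgHom p ϖ A).toLinearMap
      fun _ => exists_uniformizer_smul_eq_of_comparisonAlgHom_eq_zero p ϖ A,
    surjective_of_isPrecomplete_of_isHausdorff (a := ϖ.1) (comparisonAlgHom p ϖ A).toLinearMap
      fun y => ?_⟩
  let x := WittVector.teichmuller p (y.coeff 0)
  have hx : (comparisonAlgHom p ϖ A (1 ⊗ₜ x)).coeff 0 = y.coeff 0 :=
    (coeff_zero_comparisonAlgHom p ϖ A (y := 0) (by rw [smul_zero, sub_self])).trans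
      (WittVector.teichmuller_coeff_zero p _)
  refine ⟨1 ⊗ₜ x, RWitt.exists_uniformizer_smul_eq p hϖ ?_⟩
  rw [← RWitt.coeffZero_apply, map_sub, RWitt.coeffZero_apply, RWitt.coeffZero_apply]
  exact sub_eq_zero.mpr hx.symm

end PerfectComparison
section PRadical

variable (p : ℕ) [Fact p.Prime]

theorem isPRadical_of_bijective_comp {k S T : Type u} [CommRing k] [CommRing S] [CommRing T]
    [Algebra k S] [Algebra k T] [CharP S p] [CharP T p] (φ : S →ₐ[k] T)
    (h : ∀ (A : Type u) [CommRing A] [Algebra k A] [CharP A p] [PerfectRing A p],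
      Function.Bijective fun f : T →ₐ[k] A => f.comp φ) :
    IsPRadical (φ : S →+* T) p := by
  let ιS := PerfectClosure.of S p
  let ιT := PerfectClosure.of T p
  let _ : Algebra k (PerfectClosure S p) := (ιS.comp (algebraMap k S)).toAlgebra
  let _ : Algebra k (PerfectClosure T p) := (ιT.comp (algebraMap k T)).toAlgebra
  obtain ⟨ψ, hψ⟩ := (h (PerfectClosure S p)).2 { ιS with commutes' := fun _ => rfl }
  replace hψ : ∀ s, ψ (φ s) = ιS s := fun s => DFunLike.congr_fun hψ s
  let Φ := PerfectRing.lift ιS (ιT.comp φ) p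
  have hΦ : ∀ s, Φ (ιS s) = ιT (φ s) := PerfectRing.lift_comp_apply ιS (ιT.comp φ) p
  let Φₐ : PerfectClosure S p →ₐ[k] PerfectClosure T p :=
    { Φ with commutes' := fun c => (hΦ _).trans (congrArg ιT (φ.commutes c)) }
  have hΦψ : Φₐ.comp ψ = { ιT with commutes' := fun _ => rfl } :=
    (h (PerfectClosure T p)).1 (AlgHom.ext fun s => (congrArg Φ (hψ s)).trans (hΦ s))
  refine ⟨fun t => ?_, fun s hs => IsPRadical.ker_le ιS p ?_⟩
  · obtain ⟨n, s, hs⟩ := IsPRadical.pow_mem ιS p (ψ t)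
    have hker : φ s - t ^ p ^ n ∈ RingHom.ker ιT := by
      rw [RingHom.mem_ker, map_sub, ← hΦ, hs, map_pow, map_pow, sub_eq_zero]
      exact congrArg (· ^ p ^ n) (DFunLike.congr_fun hΦψ t)
    obtain ⟨m, hm⟩ := sub_mem_pNilradical_iff_pow_expChar_pow_eq.mp (IsPRadical.ker_le ιT p hker)
    exact ⟨n + m, s ^ p ^ m, by rw [map_pow, pow_add, pow_mul]; exact hm⟩
  · rw [RingHom.mem_ker, ← hψ, show φ s = 0 from hs, map_zero]

/-- The sequence `S → S → ⋯` of copies of a ring with the Frobenius as transition maps, whose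
spectrum is `frobeniusTower p S`. -/
noncomputable abbrev frobeniusSequence (S : CommRingCat.{u}) [CharP S p] : ℕ ⥤ CommRingCat.{u} :=
  Functor.ofSequence (X := fun _ => S) fun _ => CommRingCat.ofHom (frobenius S p)

/-- The morphism of Frobenius sequences induced by a homomorphism of rings. -/
noncomputable def frobeniusSequenceMap {S T : CommRingCat.{u}} [CharP S p] [CharP T p]
    (f : S ⟶ T) : frobeniusSequence p S ⟶ frobeniusSequence p T :=
  NatTrans.ofSequence (fun _ => f) fun n => by
    rw [Functor.ofSequence_map_homOfLE_succ, Functor.ofSequence_map_homOfLE_succ]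
    ext x
    exact map_pow f.hom x p

theorem frobeniusSequence_map {S : CommRingCat.{u}} [CharP S p] {i j : ℕ} (f : i ⟶ j) :
    (frobeniusSequence p S).map f = CommRingCat.ofHom (iterateFrobenius S p (j - i)) := by
  obtain ⟨n, rfl⟩ := Nat.exists_eq_add_of_le (leOfHom f)
  obtain rfl : f = homOfLE (Nat.le_add_right i n) := rfl
  rw [Nat.add_sub_cancel_left]
  induction n with
  | zero =>
    rw [iterateFrobenius_zero]
    exact (frobeniusSequence p S).map_id i
  | succ n ih =>
    rw [← homOfLE_comp (Nat.le_add_right i n) (Nat.le_succ (i + n)), Functor.map_comp,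
      Functor.ofSequence_map_homOfLE_succ, ih, add_comm n 1, iterateFrobenius_add,
      iterateFrobenius_one, CommRingCat.ofHom_comp]
    rfl

instance preservesFilteredColimits_forget_commRingCat :
    PreservesFilteredColimitsOfSize.{0, 0} (forget CommRingCat.{u}) :=
  preservesFilteredColimitsOfSize_shrink.{0, u, 0, u} (forget CommRingCat.{u})

section Perfection

variable {S T : CommRingCat.{u}} [CharP S p] [CharP T p]

theorem colimit_ι_frobeniusSequence_pow (n m : ℕ) (s : S) :
    colimit.ι (frobeniusSequence p S) (n + m) (s ^ p ^ m) =
      colimit.ι (frobeniusSequence p S) n s := by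
  have h := ConcreteCategory.congr_hom
    (colimit.w (frobeniusSequence p S) (homOfLE (Nat.le_add_right n m))) s
  rw [frobeniusSequence_map, Nat.add_sub_cancel_left] at h
  exact h

theorem colimit_ι_frobeniusSequence_eq_zero_iff {n : ℕ} {s : S} :
    colimit.ι (frobeniusSequence p S) n s = 0 ↔ s ∈ pNilradical S p := by
  rw [mem_pNilradical, ← map_zero (colimit.ι (frobeniusSequence p S) n).hom]
  constructor
  · intro h
    obtain ⟨m, i, j, hij⟩ := (Concrete.colimit_rep_eq_iff_exists _ _ _).mp h
    rw [frobeniusSequence_map, frobeniusSequence_map] at hij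
    exact ⟨m - n, hij.trans (map_zero (iterateFrobenius S p (m - n)))⟩
  · rintro ⟨m, hm⟩
    refine (colimit_ι_frobeniusSequence_pow p n m s).symm.trans ?_
    rw [hm]
    exact (map_zero (colimit.ι (frobeniusSequence p S) (n + m)).hom).trans
      (map_zero (colimit.ι (frobeniusSequence p S) n).hom).symm

theorem bijective_colimMap_frobeniusSequenceMap (f : S ⟶ T) [IsPRadical f.hom p] :
    Function.Bijective (colimMap (frobeniusSequenceMap p f)) := by
  have hι : ∀ n (s : S),
      colimMap (frobeniusSequenceMap p f) (colimit.ι (frobeniusSequence p S) n s) =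
        colimit.ι (frobeniusSequence p T) n (f s) := fun n =>
    ConcreteCategory.congr_hom (ι_colimMap (frobeniusSequenceMap p f) n)
  constructor
  · refine (injective_iff_map_eq_zero (colimMap (frobeniusSequenceMap p f)).hom).mpr
      fun x hx => ?_
    obtain ⟨n, s, rfl⟩ : ∃ n, ∃ s : S, colimit.ι (frobeniusSequence p S) n s = x :=
      Concrete.colimit_exists_rep _ x
    refine (colimit_ι_frobeniusSequence_eq_zero_iff p).mpr ?_
    rw [← IsPRadical.comap_pNilradical f.hom]
    exact (colimit_ι_frobeniusSequence_eq_zero_iff p).mp ((hι n s).symm.trans hx)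
  · intro y
    obtain ⟨n, t, rfl⟩ : ∃ n, ∃ t : T, colimit.ι (frobeniusSequence p T) n t = y :=
      Concrete.colimit_exists_rep _ y
    obtain ⟨m, s, hs⟩ := IsPRadical.pow_mem f.hom p t
    refine ⟨colimit.ι (frobeniusSequence p S) (n + m) s, (hι _ _).trans ?_⟩
    exact (congrArg _ hs).trans (colimit_ι_frobeniusSequence_pow p n m t)

theorem isIso_limMap_spec {J : Type} [SmallCategory J] {F G : J ⥤ CommRingCat.{u}} (α : F ⟶ G)
    [IsIso (colimMap α)] :
    IsIso (limMap (Functor.whiskerRight (NatTrans.op α) Scheme.Spec)) := by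
  let hF := isLimitOfPreserves Scheme.Spec (colimit.isColimit F).op
  let hG := isLimitOfPreserves Scheme.Spec (colimit.isColimit G).op
  let eF : Spec (colimit F) ≅ limit (F.op ⋙ Scheme.Spec) :=
    hF.conePointUniqueUpToIso (limit.isLimit _)
  let eG : Spec (colimit G) ≅ limit (G.op ⋙ Scheme.Spec) :=
    hG.conePointUniqueUpToIso (limit.isLimit _)
  have hcomm : eG.hom ≫ limMap (Functor.whiskerRight (NatTrans.op α) Scheme.Spec) =
      Spec.map (colimMap α) ≫ eF.hom := by
    refine limit.hom_ext fun j => ?_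
    have hGj : eG.hom ≫ limit.π (G.op ⋙ Scheme.Spec) j = Spec.map (colimit.ι G j.unop) :=
      hG.conePointUniqueUpToIso_hom_comp _ j
    have hFj : eF.hom ≫ limit.π (F.op ⋙ Scheme.Spec) j = Spec.map (colimit.ι F j.unop) :=
      hF.conePointUniqueUpToIso_hom_comp _ j
    rw [Category.assoc, Category.assoc, limMap_π, hFj, ← Category.assoc, hGj, ← Spec.map_comp,
      ι_colimMap α j.unop, Spec.map_comp]
    rfl
  rw [← Iso.eq_inv_comp] at hcomm
  rw [hcomm]
  infer_instance

theorem isIso_perfectionMap (f : S ⟶ T) [IsPRadical f.hom p] : IsIso (perfectionMap p f) := by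
  have : IsIso (colimMap (frobeniusSequenceMap p f)) :=
    (ConcreteCategory.isIso_iff_bijective _).mpr (bijective_colimMap_frobeniusSequenceMap p f)
  exact isIso_limMap_spec (frobeniusSequenceMap p f)

end Perfection

theorem isUniversalHomeomorphism_of_isIntegralHom {X Y : Scheme.{u}} (f : X ⟶ Y)
    [IsIntegralHom f] [UniversallyInjective f] [AlgebraicGeometry.Surjective f] :
    IsUniversalHomeomorphism f := by
  intro X' Y' i₁ i₂ f' hp
  have : IsIntegralHom f' := MorphismProperty.of_isPullback hp.flip ‹_›
  have : UniversallyInjective f' := MorphismProperty.of_isPullback hp.flip ‹_›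
  have : AlgebraicGeometry.Surjective f' := MorphismProperty.of_isPullback hp.flip ‹_›
  exact isHomeomorph_iff_continuous_isClosedMap_bijective.mpr
    ⟨f'.continuous, f'.isClosedMap, f'.injective, f'.surjective⟩

variable {S T : CommRingCat.{u}} [CharP T p]

theorem universallyInjective_specMap_of_isPRadical (f : S ⟶ T) [IsPRadical f.hom p] :
    UniversallyInjective (Spec.map f) := by
  refine ((tfae_universallyInjective (Spec.map f)).out 0 1).mpr ?_
  intro K _ g₁ g₂ hg
  obtain ⟨g₁, rfl⟩ := Spec.map_surjective g₁
  obtain ⟨g₂, rfl⟩ := Spec.map_surjective g₂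
  simp only [← Spec.map_comp] at hg
  have : CharP K p := (CharP.charP_iff_prime_eq_zero (Fact.out : p.Prime)).mpr (by
    rw [← map_natCast g₁.hom, CharP.cast_eq_zero, map_zero])
  exact congrArg Spec.map (CommRingCat.hom_ext (IsPRadical.injective_comp K f.hom p
    (congrArg CommRingCat.Hom.hom (Spec.map_injective hg))))

theorem isUniversalHomeomorphism_specMap_of_isPRadical (f : S ⟶ T) [IsPRadical f.hom p] :
    IsUniversalHomeomorphism (Spec.map f) := by
  have hpow : ∀ t : T, ∃ n > 0, t ^ n ∈ f.hom.range := fun t =>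
    have ⟨n, s, hs⟩ := IsPRadical.pow_mem f.hom p t
    ⟨p ^ n, pow_pos (Fact.out : p.Prime).pos n, s, hs⟩
  have hint : f.hom.IsIntegral := fun t =>
    have ⟨_, hn, s, hs⟩ := hpow t
    let _ := f.hom.toAlgebra
    IsIntegral.of_pow hn (hs ▸ isIntegral_algebraMap (x := s))
  have hker : RingHom.ker f.hom ≤ nilradical S :=
    (IsPRadical.ker_le f.hom p).trans pNilradical_le_nilradical
  have : IsIntegralHom (Spec.map f) := IsIntegralHom.SpecMap_iff.mpr hint
  have := universallyInjective_specMap_of_isPRadical p f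
  have : AlgebraicGeometry.Surjective (Spec.map f) :=
    (surjective_iff _).mpr (PrimeSpectrum.isHomeomorph_comap f.hom hpow hker).surjective
  exact isUniversalHomeomorphism_of_isIntegralHom _

end PRadical

section ComparisonPRadical

variable (p : ℕ) [Fact p.Prime] {O : Type u} [CommRing O] [IsDomain O]
  [IsDiscreteValuationRing O] [Finite (ResidueField O)] [IsAdicComplete (maximalIdeal O) O]
  [CharP (ResidueField O) p] (ϖ : Uniformizer O) [CharZero O]

theorem bijective_comp_comparisonCoord (A : Type u) [CommRing A] [Algebra (ResidueField O) A]
    [CharP A p] [PerfectRing A p] :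
    Function.Bijective fun f : greenbergRing p O →ₐ[ResidueField O] A =>
      f.comp (comparisonCoord p ϖ).hom := by
  let _ := residueAlgebra (O := O) A
  have : IsScalarTower O (ResidueField O) A := IsScalarTower.of_algebraMap_eq fun _ => rfl
  let B := CommAlgCat.of (ResidueField O) A
  let eR : (MvPolynomial ℕ (ResidueField O) →ₐ[ResidueField O] A) ≃ RWitt ϖ A :=
    ConcreteCategory.homEquiv.symm.trans ((rwittCorepresentableBy ϖ).homEquiv (Y := B))
  have hpoints : (fun f : greenbergRing p O →ₐ[ResidueField O] A =>
      f.comp (comparisonCoord p ϖ).hom) =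
        eR.symm ∘ comparisonAlgHom p ϖ A ∘ greenbergPoints p O A :=
    funext fun f => eR.eq_symm_apply.mpr (comparisonCoord_points p ϖ B (CommAlgCat.ofHom f))
  rw [hpoints]
  exact eR.symm.bijective.comp
    ((bijective_comparisonAlgHom p ϖ A).comp (greenbergPoints p O A).bijective)

instance isPRadical_comparisonRingHom : IsPRadical (comparisonRingHom p ϖ).hom p :=
  isPRadical_of_bijective_comp p (k := ResidueField O) (S := MvPolynomial ℕ (ResidueField O))
    (comparisonCoord p ϖ).hom fun A => bijective_comp_comparisonCoord p ϖ A

end ComparisonPRadical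

section AlgHom

variable {k R H A : Type*} [CommRing k] [CommRing R] [Algebra k R] [CommRing H] [Algebra k H]
  [CommRing A] [Algebra k A]

theorem exists_algHom_comp_eq_of_directed_range {ι : Type*} [Nonempty ι] {R : ι → Type*}
    [∀ i, CommRing (R i)] [∀ i, Algebra k (R i)] (f : ∀ i, R i →ₐ[k] H)
    (hdir : Directed (· ≤ ·) fun i => (f i).range) (htop : ⨆ i, (f i).range = ⊤)
    (φ : ∀ i, R i →ₐ[k] A) (hφ : ∀ i j r s, f i r = f j s → φ i r = φ j s) :
    ∃ χ : H →ₐ[k] A, ∀ i, χ.comp (f i) = φ i := by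
  have hker : ∀ i, RingHom.ker (f i).rangeRestrict ≤ RingHom.ker (φ i) := fun i r hr =>
    (hφ i i r 0 ((congrArg Subtype.val hr).trans (map_zero (f i)).symm)).trans (map_zero (φ i))
  let ψ : ∀ i, (f i).range →ₐ[k] A := fun i =>
    (f i).rangeRestrict.liftOfSurjective (f i).rangeRestrict_surjective (φ i) (hker i)
  have hψφ : ∀ i r, ψ i ((f i).rangeRestrict r) = φ i r := fun i =>
    AlgHom.liftOfSurjective_apply _ _ _ _
  have hψ : ∀ i j (h : (f i).range ≤ (f j).range),
      ψ i = (ψ j).comp (Subalgebra.inclusion h) := fun i j h => AlgHom.ext fun x => by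
    obtain ⟨r, rfl⟩ := (f i).rangeRestrict_surjective x
    obtain ⟨s, hs⟩ := h ⟨r, rfl⟩
    have hrs : Subalgebra.inclusion h ((f i).rangeRestrict r) = (f j).rangeRestrict s :=
      Subtype.ext hs.symm
    rw [AlgHom.comp_apply, hrs, hψφ, hψφ]
    exact hφ i j r s hs.symm
  refine ⟨(Subalgebra.iSupLift _ hdir ψ hψ ⊤ htop.ge).comp Subalgebra.topEquiv.symm.toAlgHom,
    fun i => AlgHom.ext fun r => ?_⟩
  exact (Subalgebra.iSupLift_mk (fun i => (f i).range) (dir := hdir) (hf := hψ)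
    ((f i).rangeRestrict r) Algebra.mem_top).trans (hψφ i r)

theorem algHom_ext_of_iSup_range {ι : Type*} {R : ι → Type*} [∀ i, CommRing (R i)]
    [∀ i, Algebra k (R i)] {f : ∀ i, R i →ₐ[k] H} (htop : ⨆ i, (f i).range = ⊤)
    {χ χ' : H →ₐ[k] A} (h : ∀ i, χ.comp (f i) = χ'.comp (f i)) : χ = χ' := by
  have hle : ⨆ i, (f i).range ≤ AlgHom.equalizer χ χ' := iSup_le fun i => by
    rintro _ ⟨r, rfl⟩
    exact DFunLike.congr_fun (h i) r
  rw [htop, top_le_iff] at hle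
  exact AlgHom.ext fun x => show x ∈ AlgHom.equalizer χ χ' from hle ▸ Algebra.mem_top

end AlgHom

section SchematicImage

variable {k : Type u} [Field k] {G W W' : CommAlgCat.{u} k ⥤ AddCommGrpCat.{u}} (α : G ⟶ W)

/-- A point of `W` lies in the schematic image of `α : G ⟶ W` if it is the specialization along
some `D ⟶ A` of a point over `D` that lifts to `G` over an extension `E` of `D`. For affine
groups over a field these are the points of the closed subgroup of `W` defined by the kernel of the
homomorphism of coordinate rings, see `isImagePoint_homEquiv_iff`. -/
def IsImagePoint {A : CommAlgCat.{u} k} (x : W.obj A) : Prop :=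
  ∃ (D E : CommAlgCat.{u} k) (d : D ⟶ A) (g : D ⟶ E) (y : W.obj D) (z : G.obj E),
    Function.Injective g.hom ∧ W.map d y = x ∧ W.map g y = α.app E z

namespace IsImagePoint

variable {α} {A B : CommAlgCat.{u} k}

theorem app (x : G.obj A) : IsImagePoint α (α.app A x) :=
  ⟨A, A, 𝟙 A, 𝟙 A, α.app A x, x, Function.injective_id, by simp, by simp⟩

theorem map (f : A ⟶ B) {x : W.obj A} (hx : IsImagePoint α x) : IsImagePoint α (W.map f x) := by
  obtain ⟨D, E, d, g, y, z, hg, rfl, hyz⟩ := hx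
  exact ⟨D, E, d ≫ f, g, y, z, hg, by simp, hyz⟩

theorem comp (ρ : W ⟶ W') {x : W.obj A} (hx : IsImagePoint α x) :
    IsImagePoint (α ≫ ρ) (ρ.app A x) := by
  obtain ⟨D, E, d, g, y, z, hg, rfl, hyz⟩ := hx
  exact ⟨D, E, d, g, ρ.app D y, z, hg, (NatTrans.naturality_apply ρ d y).symm, by
    rw [← NatTrans.naturality_apply, hyz, NatTrans.comp_app, ConcreteCategory.comp_apply]⟩

theorem neg {x : W.obj A} (hx : IsImagePoint α x) : IsImagePoint α (-x) := by
  obtain ⟨D, E, d, g, y, z, hg, rfl, hyz⟩ := hx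
  exact ⟨D, E, d, g, -y, -z, hg, by simp, by simp [hyz]⟩

theorem add {x x' : W.obj A} (hx : IsImagePoint α x) (hx' : IsImagePoint α x') :
    IsImagePoint α (x + x') := by
  obtain ⟨D, E, d, g, y, z, hg, rfl, hyz⟩ := hx
  obtain ⟨D', E', d', g', y', z', hg', rfl, hyz'⟩ := hx'
  let D₂ := CommAlgCat.of k (D ⊗[k] D')
  let E₂ := CommAlgCat.of k (E ⊗[k] E')
  let l : D ⟶ D₂ := CommAlgCat.ofHom Algebra.TensorProduct.includeLeft
  let r : D' ⟶ D₂ := CommAlgCat.ofHom Algebra.TensorProduct.includeRight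
  let L : E ⟶ E₂ := CommAlgCat.ofHom Algebra.TensorProduct.includeLeft
  let R : E' ⟶ E₂ := CommAlgCat.ofHom Algebra.TensorProduct.includeRight
  let dd : D₂ ⟶ A := CommAlgCat.ofHom
    (Algebra.TensorProduct.lift d.hom d'.hom fun _ _ => Commute.all _ _)
  let gg : D₂ ⟶ E₂ := CommAlgCat.ofHom (Algebra.TensorProduct.map g.hom g'.hom)
  have hld : l ≫ dd = d := CommAlgCat.hom_ext
    (Algebra.TensorProduct.lift_comp_includeLeft _ _ fun _ _ => Commute.all _ _)
  have hrd : r ≫ dd = d' := CommAlgCat.hom_ext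
    (Algebra.TensorProduct.lift_comp_includeRight' _ _ fun _ _ => Commute.all _ _)
  have hlg : l ≫ gg = g ≫ L := CommAlgCat.hom_ext
    (Algebra.TensorProduct.map_comp_includeLeft _ _)
  have hrg : r ≫ gg = g' ≫ R := CommAlgCat.hom_ext
    (Algebra.TensorProduct.map_comp_includeRight _ _)
  refine ⟨D₂, E₂, dd, gg, W.map l y + W.map r y', G.map L z + G.map R z',
    TensorProduct.map_injective_of_flat_flat g.hom.toLinearMap g'.hom.toLinearMap hg hg', ?_, ?_⟩
  · rw [map_add, ← ConcreteCategory.comp_apply, ← ConcreteCategory.comp_apply, ← W.map_comp,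
      ← W.map_comp, hld, hrd]
  · rw [map_add, map_add, NatTrans.naturality_apply, NatTrans.naturality_apply, ← hyz, ← hyz']
    simp only [← ConcreteCategory.comp_apply, ← W.map_comp, hlg, hrg]

end IsImagePoint

/-- The subgroup of the `A`-points of `W` that lie in the schematic image of `α`. -/
def imageSubgroup (A : CommAlgCat.{u} k) : AddSubgroup (W.obj A) where
  carrier := {x | IsImagePoint α x}
  zero_mem' := map_zero (α.app A).hom ▸ IsImagePoint.app (0 : G.obj A)
  add_mem' := IsImagePoint.add
  neg_mem' := IsImagePoint.neg

/-- The schematic image of a homomorphism of commutative `k`-groups, as a group functor. -/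
def schematicImage : CommAlgCat.{u} k ⥤ AddCommGrpCat.{u} where
  obj A := AddCommGrpCat.of (imageSubgroup α A)
  map {A B} f := AddCommGrpCat.ofHom <|
    ((W.map f).hom.comp (imageSubgroup α A).subtype).codRestrict (imageSubgroup α B)
      fun x => x.2.map f
  map_id A := by
    ext x
    exact ConcreteCategory.congr_hom (W.map_id A) x.1
  map_comp f g := by
    ext x
    exact ConcreteCategory.congr_hom (W.map_comp f g) x.1

variable {α} in
/-- The homomorphism between schematic images induced by a homomorphism of the targets. -/
def schematicImageMap (ρ : W ⟶ W') {β : G ⟶ W'} (h : α ≫ ρ = β) :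
    schematicImage α ⟶ schematicImage β where
  app A := AddCommGrpCat.ofHom <|
    ((ρ.app A).hom.comp (imageSubgroup α A).subtype).codRestrict (imageSubgroup β A)
      fun x => h ▸ x.2.comp ρ
  naturality A B f := by
    ext x
    exact Subtype.ext (NatTrans.naturality_apply ρ f x.1)

/-- The homomorphism from the source onto the schematic image. -/
def toSchematicImage : G ⟶ schematicImage α where
  app A := AddCommGrpCat.ofHom <|
    (α.app A).hom.codRestrict (imageSubgroup α A) IsImagePoint.app
  naturality A B f := by
    ext x
    exact Subtype.ext (NatTrans.naturality_apply α f x)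

section Coordinates

variable {α} {H R R' : CommAlgCat.{u} k} (hG : (G ⋙ forget AddCommGrpCat).CorepresentableBy H)
  (hW : (W ⋙ forget AddCommGrpCat).CorepresentableBy R)
  (hW' : (W' ⋙ forget AddCommGrpCat).CorepresentableBy R')

variable (α) in
/-- The homomorphism of coordinate rings of a homomorphism between affine groups. -/
def coordinateHom : R ⟶ H :=
  hW.homEquiv.symm (α.app H (hG.homEquiv (𝟙 H)))

theorem homEquiv_coordinateHom_comp {A : CommAlgCat.{u} k} (φ : H ⟶ A) :
    hW.homEquiv (coordinateHom α hG hW ≫ φ) = α.app A (hG.homEquiv φ) := by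
  rw [hW.homEquiv_comp, coordinateHom, Equiv.apply_symm_apply, hG.homEquiv_eq φ]
  exact (NatTrans.naturality_apply α φ _).symm

theorem coordinateHom_comp (ρ : W ⟶ W') :
    coordinateHom (α ≫ ρ) hG hW' = coordinateHom ρ hW hW' ≫ coordinateHom α hG hW :=
  hW'.homEquiv.injective <| by
    rw [homEquiv_coordinateHom_comp, coordinateHom, Equiv.apply_symm_apply,
      ← Category.comp_id (coordinateHom α hG hW), homEquiv_coordinateHom_comp]
    rfl

theorem isImagePoint_homEquiv_iff {A : CommAlgCat.{u} k} (φ : R ⟶ A) :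
    IsImagePoint α (hW.homEquiv φ) ↔
      RingHom.ker (coordinateHom α hG hW).hom ≤ RingHom.ker φ.hom := by
  let f := coordinateHom α hG hW
  constructor
  · rintro ⟨D, E, d, g, y, z, hg, hdy, hgy⟩ r hr
    obtain ⟨δ, rfl⟩ := hW.homEquiv.surjective y
    obtain ⟨ζ, rfl⟩ := hG.homEquiv.surjective z
    have hφ : δ ≫ d = φ := hW.homEquiv.injective ((hW.homEquiv_comp d δ).trans hdy)
    have hδ : δ ≫ g = f ≫ ζ := hW.homEquiv.injective <|
      (hW.homEquiv_comp g δ).trans (hgy.trans (homEquiv_coordinateHom_comp hG hW ζ).symm)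
    have hδr : δ.hom r = 0 := hg <| by
      refine (ConcreteCategory.congr_hom hδ r).trans ?_
      exact (congrArg ζ.hom hr).trans (by simp only [map_zero])
    rw [← hφ]
    exact (congrArg d.hom hδr).trans (map_zero _)
  · intro hker
    let D := CommAlgCat.of k f.hom.range
    let δ : R ⟶ D := CommAlgCat.ofHom f.hom.rangeRestrict
    let d : D ⟶ A := CommAlgCat.ofHom <|
      f.hom.rangeRestrict.liftOfSurjective f.hom.rangeRestrict_surjective φ.hom
        (f.hom.ker_rangeRestrict.trans_le hker)
    have hδd : δ ≫ d = φ := CommAlgCat.hom_ext (AlgHom.liftOfSurjective_comp _ _ _ _)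
    refine ⟨D, H, d, CommAlgCat.ofHom f.hom.range.val, hW.homEquiv δ, hG.homEquiv (𝟙 H),
      Subtype.val_injective, ?_, ?_⟩
    · rw [← hδd]
      exact (hW.homEquiv_comp d δ).symm
    · rw [← homEquiv_coordinateHom_comp hG hW]
      exact (hW.homEquiv_comp _ δ).symm

theorem isImagePoint_rangeRestrict_comp {A : CommAlgCat.{u} k}
    (φ : CommAlgCat.of k (coordinateHom α hG hW).hom.range ⟶ A) :
    IsImagePoint α
      (hW.homEquiv (CommAlgCat.ofHom (coordinateHom α hG hW).hom.rangeRestrict ≫ φ)) := by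
  rw [isImagePoint_homEquiv_iff hG hW, ← AlgHom.ker_rangeRestrict]
  exact fun r hr => (congrArg φ.hom hr).trans (map_zero φ.hom)

/-- The schematic image is the spectrum of the image of the homomorphism of coordinate rings. -/
noncomputable def schematicImageCorepresentableBy :
    (schematicImage α ⋙ forget AddCommGrpCat).CorepresentableBy
      (CommAlgCat.of k (coordinateHom α hG hW).hom.range) where
  homEquiv {A} := Equiv.ofBijective
    (fun φ => (⟨_, isImagePoint_rangeRestrict_comp hG hW φ⟩ : imageSubgroup α A)) <| by
    let f := (coordinateHom α hG hW).hom
    constructor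
    · intro φ φ' h
      have hφ := hW.homEquiv.injective (congrArg Subtype.val h)
      ext x
      obtain ⟨r, rfl⟩ := f.rangeRestrict_surjective x
      exact ConcreteCategory.congr_hom hφ r
    · rintro ⟨x, hx⟩
      obtain ⟨φ, rfl⟩ := hW.homEquiv.surjective x
      have hker : RingHom.ker f.rangeRestrict ≤ RingHom.ker φ.hom :=
        f.ker_rangeRestrict.trans_le ((isImagePoint_homEquiv_iff hG hW φ).mp hx)
      exact ⟨CommAlgCat.ofHom <|
          f.rangeRestrict.liftOfSurjective f.rangeRestrict_surjective φ.hom hker,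
        Subtype.ext <| congrArg hW.homEquiv <|
          CommAlgCat.hom_ext (AlgHom.liftOfSurjective_comp _ _ _ hker)⟩
  homEquiv_comp f g := Subtype.ext <|
    hW.homEquiv_comp f (CommAlgCat.ofHom (coordinateHom α hG hW).hom.rangeRestrict ≫ g)

end Coordinates

section Cone

variable {J : Type u} [SmallCategory J] {F : J ⥤ CommAlgCat.{u} k ⥤ AddCommGrpCat.{u}}
  (c : Cone F)

/-- The diagram of the schematic images of the legs of a cone of commutative `k`-groups. -/
def imageDiagram : J ⥤ CommAlgCat.{u} k ⥤ AddCommGrpCat.{u} where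
  obj j := schematicImage (c.π.app j)
  map f := schematicImageMap (F.map f) (c.w f)
  map_id j := by
    ext A x
    exact Subtype.ext (ConcreteCategory.congr_hom (NatTrans.congr_app (F.map_id j) A) x.1)
  map_comp f g := by
    ext A x
    exact Subtype.ext (ConcreteCategory.congr_hom (NatTrans.congr_app (F.map_comp f g) A) x.1)

/-- The apex of a cone of commutative `k`-groups as a cone over the schematic images of its
legs. -/
def imageCone : Cone (imageDiagram c) where
  pt := c.pt
  π :=
    { app := fun j => toSchematicImage (c.π.app j)
      naturality := fun i j f => by
        ext A x
        exact Subtype.ext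
          (ConcreteCategory.congr_hom (NatTrans.congr_app (c.w f) A) x).symm }

variable {c} {H : CommAlgCat.{u} k} {R : J → CommAlgCat.{u} k}
  (hG : (c.pt ⋙ forget AddCommGrpCat).CorepresentableBy H)
  (hF : ∀ j, (F.obj j ⋙ forget AddCommGrpCat).CorepresentableBy (R j))

theorem exists_coordinateHom_eq_comp [IsCofiltered J] (i j : J) :
    ∃ (l : J) (u : l ⟶ i) (v : l ⟶ j),
      coordinateHom (c.π.app i) hG (hF i) =
        coordinateHom (F.map u) (hF l) (hF i) ≫ coordinateHom (c.π.app l) hG (hF l) ∧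
      coordinateHom (c.π.app j) hG (hF j) =
        coordinateHom (F.map v) (hF l) (hF j) ≫ coordinateHom (c.π.app l) hG (hF l) := by
  refine ⟨IsCofiltered.min i j, IsCofiltered.minToLeft i j, IsCofiltered.minToRight i j, ?_, ?_⟩
  all_goals rw [← coordinateHom_comp, c.w]

theorem directed_range_coordinateHom [IsCofiltered J] :
    Directed (· ≤ ·) fun j => (coordinateHom (c.π.app j) hG (hF j)).hom.range := fun i j => by
  obtain ⟨l, u, v, hu, hv⟩ := exists_coordinateHom_eq_comp hG hF i j
  refine ⟨l, ?_, ?_⟩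
  · dsimp only
    rw [hu]
    exact AlgHom.range_comp_le_range _ _
  · dsimp only
    rw [hv]
    exact AlgHom.range_comp_le_range _ _

theorem exists_coordinateHom_comp_eq [IsCofiltered J]
    (htop : ⨆ j, (coordinateHom (c.π.app j) hG (hF j)).hom.range = ⊤) {A : CommAlgCat.{u} k}
    (φ : ∀ j, R j ⟶ A)
    (hφ : ∀ {i j} (u : i ⟶ j), coordinateHom (F.map u) (hF i) (hF j) ≫ φ i = φ j)
    (hker : ∀ j, RingHom.ker (coordinateHom (c.π.app j) hG (hF j)).hom ≤
      RingHom.ker (φ j).hom) :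
    ∃ χ : H ⟶ A, ∀ j, coordinateHom (c.π.app j) hG (hF j) ≫ χ = φ j := by
  have hcompat : ∀ i j r r', (coordinateHom (c.π.app i) hG (hF i)).hom r =
      (coordinateHom (c.π.app j) hG (hF j)).hom r' → (φ i).hom r = (φ j).hom r' := by
    intro i j r r' h
    obtain ⟨l, u, v, hu, hv⟩ := exists_coordinateHom_eq_comp hG hF i j
    rw [← hφ u, ← hφ v, ← sub_eq_zero]
    rw [hu, hv, ← sub_eq_zero] at h
    simp only [CommAlgCat.hom_comp, AlgHom.comp_apply, ← map_sub] at h ⊢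
    exact hker l h
  have : Nonempty J := IsCofiltered.nonempty
  obtain ⟨χ, hχ⟩ := exists_algHom_comp_eq_of_directed_range _
    (directed_range_coordinateHom hG hF) htop (fun j => (φ j).hom) hcompat
  exact ⟨CommAlgCat.ofHom χ, fun j => CommAlgCat.hom_ext (hχ j)⟩

theorem nonempty_isLimit_imageCone [IsCofiltered J]
    (htop : ⨆ j, (coordinateHom (c.π.app j) hG (hF j)).hom.range = ⊤) :
    Nonempty (IsLimit (imageCone c)) := by
  refine ⟨evaluationJointlyReflectsLimits _ fun A =>
    isLimitOfReflects (forget AddCommGrpCat) (Nonempty.some ?_)⟩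
  rw [Types.isLimit_iff]
  intro s hs
  let x : ∀ j, imageSubgroup (c.π.app j) A := s
  let φ : ∀ j, R j ⟶ A := fun j => (hF j).homEquiv.symm (x j).1
  have hφ : ∀ j, (hF j).homEquiv (φ j) = (x j).1 := fun j => (hF j).homEquiv.apply_symm_apply _
  have hφmap : ∀ {i j} (u : i ⟶ j), coordinateHom (F.map u) (hF i) (hF j) ≫ φ i = φ j :=
    fun u => (hF _).homEquiv.injective <| by
      rw [homEquiv_coordinateHom_comp, hφ, hφ]
      exact congrArg Subtype.val (hs u)
  obtain ⟨χ, hχ⟩ := exists_coordinateHom_comp_eq hG hF htop φ hφmap fun j =>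
    (isImagePoint_homEquiv_iff hG (hF j) (φ j)).mp ((hφ j).symm ▸ (x j).2)
  refine ⟨hG.homEquiv χ, fun j => Subtype.ext ?_, fun y hy => ?_⟩
  · exact (homEquiv_coordinateHom_comp hG (hF j) χ).symm.trans
      ((congrArg (hF j).homEquiv (hχ j)).trans (hφ j))
  · obtain ⟨ψ, rfl⟩ := hG.homEquiv.surjective y
    have hψ : ∀ j, coordinateHom (c.π.app j) hG (hF j) ≫ ψ = φ j := fun j =>
      (hF j).homEquiv.injective <| (homEquiv_coordinateHom_comp hG (hF j) ψ).trans
        ((congrArg Subtype.val (hy j)).trans (hφ j).symm)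
    exact congrArg hG.homEquiv <| CommAlgCat.hom_ext <| algHom_ext_of_iSup_range htop fun j =>
      congrArg CommAlgCat.Hom.hom ((hψ j).trans (hχ j).symm)

end Cone

end SchematicImage

section Infinitesimal

variable {k : Type u} [Field k]

theorem isInfinitesimal_of_isNilpotent_sub {G : CommAlgCat.{u} k ⥤ AddCommGrpCat.{u}}
    {S : CommAlgCat.{u} k} (hG : (G ⋙ forget AddCommGrpCat).CorepresentableBy S)
    [Algebra.FiniteType k S] (hnil : ∀ s : S, ∃ c : k, IsNilpotent (s - algebraMap k S c)) :
    IsInfinitesimal G := by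
  refine ⟨S, ⟨hG⟩, ?_, ?_⟩
  · have : Algebra.IsIntegral k S := ⟨fun s => by
      obtain ⟨c, m, hm⟩ := hnil s
      refine ⟨(Polynomial.X - Polynomial.C c) ^ m, (Polynomial.monic_X_sub_C c).pow m, ?_⟩
      simpa using hm⟩
    exact Algebra.IsIntegral.finite
  · have : Nontrivial S :=
      (hG.homEquiv.symm (0 : G.obj (CommAlgCat.of k k))).hom.toRingHom.domain_nontrivial
    refine IsLocalRing.of_isUnit_or_isUnit_one_sub_self fun s : S => ?_
    obtain ⟨c, hc⟩ := hnil s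
    rcases eq_or_ne c 0 with rfl | hc₀
    · rw [map_zero, sub_zero] at hc
      exact .inr hc.isUnit_one_sub
    · have hunit := hc.isUnit_add_left_of_commute ((IsUnit.mk0 c hc₀).map (algebraMap k S))
        (Commute.all _ _)
      rw [add_sub_cancel] at hunit
      exact .inl hunit

theorem isProInfinitesimal_of_cone {J : Type u} [SmallCategory J] [IsCofiltered J]
    {F : J ⥤ CommAlgCat.{u} k ⥤ AddCommGrpCat.{u}} (c : Cone F) {H : CommAlgCat.{u} k}
    {R : J → CommAlgCat.{u} k} (hG : (c.pt ⋙ forget AddCommGrpCat).CorepresentableBy H)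
    (hF : ∀ j, (F.obj j ⋙ forget AddCommGrpCat).CorepresentableBy (R j))
    [∀ j, Algebra.FiniteType k (R j)]
    (htop : ⨆ j, (coordinateHom (c.π.app j) hG (hF j)).hom.range = ⊤)
    (hnil : ∀ h : H, ∃ a : k, IsNilpotent (h - algebraMap k H a)) :
    IsProInfinitesimal c.pt := by
  refine ⟨J, inferInstance, inferInstance, imageDiagram c, imageCone c,
    nonempty_isLimit_imageCone hG hF htop, ⟨Iso.refl _⟩, fun j => ?_⟩
  let f := (coordinateHom (c.π.app j) hG (hF j)).hom
  have : Algebra.FiniteType k f.range := .of_surjective f.rangeRestrict f.rangeRestrict_surjective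
  refine isInfinitesimal_of_isNilpotent_sub (schematicImageCorepresentableBy hG (hF j))
    fun s : f.range => ?_
  obtain ⟨a, ha⟩ := hnil s
  exact ⟨a, (IsNilpotent.map_iff (f := f.range.val) Subtype.val_injective).mp ha⟩

end Infinitesimal

section TruncatedWitt

variable (p : ℕ) [Fact p.Prime] (n : ℕ)

section Map

variable {p n} {R S : Type*} [CommRing R] [CommRing S]

theorem truncate_map_eq_mk (f : R →+* S) (x : WittVector p R) :
    WittVector.truncate n (WittVector.map f x) =
      TruncatedWittVector.mk p fun i => f ((WittVector.truncate n x).coeff i) := by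
  ext i
  rw [WittVector.coeff_truncate, WittVector.map_coeff, TruncatedWittVector.coeff_mk,
    WittVector.coeff_truncate]

variable (n) in
/-- The additive map on truncated Witt vectors induced by a ring homomorphism, which acts on each
component. -/
noncomputable def truncatedWittMap (f : R →+* S) :
    TruncatedWittVector p n R →+ TruncatedWittVector p n S where
  toFun x := TruncatedWittVector.mk p fun i => f (x.coeff i)
  map_zero' := by rw [← map_zero (WittVector.truncate n), ← truncate_map_eq_mk, map_zero, map_zero]
  map_add' x y := by
    obtain ⟨x, rfl⟩ := WittVector.truncate_surjective p n R x
    obtain ⟨y, rfl⟩ := WittVector.truncate_surjective p n R y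
    simp only [← map_add, ← truncate_map_eq_mk]

theorem coeff_truncatedWittMap (f : R →+* S) (x : TruncatedWittVector p n R) (i : Fin n) :
    (truncatedWittMap n f x).coeff i = f (x.coeff i) :=
  TruncatedWittVector.coeff_mk _ _

end Map

variable (k : Type u) [Field k] (ι : Type)

/-- The `k`-group of families of truncated Witt vectors of length `n`. -/
noncomputable def truncatedWittGroup : CommAlgCat.{u} k ⥤ AddCommGrpCat.{u} where
  obj A := AddCommGrpCat.of (ι → TruncatedWittVector p n A)
  map f := AddCommGrpCat.ofHom ((truncatedWittMap n (f.hom : _ →+* _)).compLeft ι)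
  map_id _ := rfl
  map_comp _ _ := rfl

/-- `k[X_{i,m} : i ∈ ι, m < n]` is the coordinate ring of `truncatedWittGroup p n k ι`. -/
noncomputable def truncatedWittGroupCorepresentableBy :
    (truncatedWittGroup p n k ι ⋙ forget AddCommGrpCat).CorepresentableBy
      (CommAlgCat.of k (MvPolynomial (ι × Fin n) k)) where
  homEquiv {A} :=
    { toFun := fun φ => (fun i => TruncatedWittVector.mk p fun m => φ.hom (MvPolynomial.X (i, m)) :
        ι → TruncatedWittVector p n A)
      invFun := fun x => CommAlgCat.ofHom <|
        MvPolynomial.aeval fun j => ((x : ι → TruncatedWittVector p n A) j.1).coeff j.2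
      left_inv := fun _ =>
        CommAlgCat.hom_ext (MvPolynomial.algHom_ext fun _ => MvPolynomial.aeval_X _ _)
      right_inv := fun _ => funext fun _ => TruncatedWittVector.ext fun _ =>
        MvPolynomial.aeval_X _ _ }
  homEquiv_comp _ _ := rfl

variable {n} in
/-- Truncation, as a homomorphism between the groups of truncated Witt vectors. -/
noncomputable def truncatedWittGroupTruncate {m : ℕ} (hnm : n ≤ m) :
    truncatedWittGroup p m k ι ⟶ truncatedWittGroup p n k ι where
  app A := AddCommGrpCat.ofHom <|
    (TruncatedWittVector.truncate (p := p) (R := A) hnm).toAddMonoidHom.compLeft ι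
  naturality A B f := by
    refine AddCommGrpCat.hom_ext (AddMonoidHom.ext fun x => funext fun i =>
      TruncatedWittVector.ext fun j => ?_)
    change (TruncatedWittVector.truncate hnm (truncatedWittMap m _ (x i))).coeff j =
      (truncatedWittMap n _ (TruncatedWittVector.truncate hnm (x i))).coeff j
    rw [TruncatedWittVector.coeff_truncate, coeff_truncatedWittMap, coeff_truncatedWittMap,
      TruncatedWittVector.coeff_truncate]

/-- The truncated Witt vector groups as an inverse system under truncation. -/
noncomputable def truncatedWittTower :
    (ULift.{u} ℕ)ᵒᵖ ⥤ CommAlgCat.{u} k ⥤ AddCommGrpCat.{u} where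
  obj n := truncatedWittGroup p n.unop.down k ι
  map f := truncatedWittGroupTruncate p k ι (ULift.down_le.mpr (leOfHom f.unop))
  map_id _ := NatTrans.ext <| funext fun _ => AddCommGrpCat.hom_ext <| AddMonoidHom.ext fun _ =>
    funext fun _ => TruncatedWittVector.ext fun _ =>
      TruncatedWittVector.coeff_truncate le_rfl _ _
  map_comp f g := NatTrans.ext <| funext fun _ => AddCommGrpCat.hom_ext <| AddMonoidHom.ext fun _ =>
    funext fun _ => (TruncatedWittVector.truncate_truncate
      (ULift.down_le.mpr (leOfHom g.unop)) (ULift.down_le.mpr (leOfHom f.unop)) _).symm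

end TruncatedWitt

section ComparisonKernel

open MvPolynomial

attribute [local instance] wittAlgebra wittMapAlgebra

variable (p : ℕ) [Fact p.Prime] {O : Type u} [CommRing O] [IsDomain O]
  [IsDiscreteValuationRing O] [Finite (ResidueField O)] [IsAdicComplete (maximalIdeal O) O]
  [CharP (ResidueField O) p] (ϖ : Uniformizer O) [CharZero O]

theorem greenbergCoordAddEquiv_map {A B : Type v} [CommRing A] [Algebra (ResidueField O) A]
    [CommRing B] [Algebra (ResidueField O) B] (f : A →ₐ[ResidueField O] B)
    (x : Fin (absRamification p O) → WittVector p A) :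
    greenbergCoordAddEquiv p O B (fun i => WittVector.map (f : A →+* B) (x i)) =
      Algebra.TensorProduct.map (AlgHom.id O O) (wittMapAlgHom p f)
        (greenbergCoordAddEquiv p O A x) := by
  change greenbergCoord p O B _ = Algebra.TensorProduct.map _ _ (greenbergCoord p O A x)
  rw [greenbergCoord_apply, greenbergCoord_apply, map_sum]
  rfl

/-- The ideal of the kernel of `r` in the coordinate ring of the Greenberg algebra. -/
noncomputable def kernelIdeal : Ideal (greenbergRing p O) :=
  Ideal.span (Set.range fun n => (comparisonCoord p ϖ).hom (X n))

theorem greenbergPoints_mem_ker_comparison_iff {A : CommAlgCat.{u} (ResidueField O)}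
    (φ : greenbergRing p O →ₐ[ResidueField O] A) :
    greenbergPoints p O A φ ∈ RingHom.ker ((comparison p ϖ).app A).hom ↔
      ∀ a ∈ kernelIdeal p ϖ, φ a = 0 := by
  have hspan : (∀ a ∈ kernelIdeal p ϖ, φ a = 0) ↔
      ∀ n, φ ((comparisonCoord p ϖ).hom (X n)) = 0 := by
    change kernelIdeal p ϖ ≤ RingHom.ker φ ↔ _
    rw [kernelIdeal, Ideal.span_le, Set.range_subset_iff]
    rfl
  have hpoints := comparisonCoord_points p ϖ A (CommAlgCat.ofHom φ)
  rw [hspan]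
  exact ⟨fun h n => congrArg (fun z : RWitt ϖ A => z.coeff n) (hpoints.trans h),
    fun h => hpoints.symm.trans (RWitt.ext (funext h))⟩

/-- The coordinate ring of the kernel of `r`. -/
abbrev kernelRing : Type u :=
  greenbergRing p O ⧸ kernelIdeal p ϖ

/-- The points of `kernelRing p ϖ` with values in `A` are the elements of the kernel of `r_A`. -/
noncomputable def kernelPoints (A : CommAlgCat.{u} (ResidueField O)) :
    (kernelRing p ϖ →ₐ[ResidueField O] A) ≃ RingHom.ker ((comparison p ϖ).app A).hom where
  toFun φ := ⟨greenbergPoints p O A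
      (φ.comp (Ideal.Quotient.mkₐ (ResidueField O) (kernelIdeal p ϖ))),
    (greenbergPoints_mem_ker_comparison_iff p ϖ _).mpr fun _ ha =>
      (congrArg φ (Ideal.Quotient.eq_zero_iff_mem.mpr ha)).trans (map_zero φ)⟩
  invFun x := Ideal.Quotient.liftₐ (kernelIdeal p ϖ) ((greenbergPoints p O A).symm x.1) <|
    (greenbergPoints_mem_ker_comparison_iff p ϖ _).mp <|
      ((greenbergPoints p O A).apply_symm_apply x.1).symm ▸ x.2
  left_inv _ := Ideal.Quotient.algHom_ext _ ((greenbergPoints p O A).symm_apply_apply _)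
  right_inv x := Subtype.ext ((greenbergPoints p O A).apply_symm_apply x.1)

/-- The kernel of `r` is represented by `kernelRing p ϖ`. -/
noncomputable def comparisonKernelCorepresentableBy :
    (comparisonKernel p ϖ ⋙ forget AddCommGrpCat).CorepresentableBy
      (CommAlgCat.of (ResidueField O) (kernelRing p ϖ)) where
  homEquiv {A} := ConcreteCategory.homEquiv.trans (kernelPoints p ϖ A)
  homEquiv_comp f g := by
    exact Subtype.ext (greenbergPoints_comp p f.hom
      (g.hom.comp (Ideal.Quotient.mkₐ (ResidueField O) (kernelIdeal p ϖ))))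

variable (O) in
/-- The coordinates of an element of `W(A) ⊗_{W(k)} O`, truncated to length `n`. -/
noncomputable def greenbergTruncate (n : ℕ) (A : Type v) [CommRing A]
    [Algebra (ResidueField O) A] :
    O ⊗[WittVector p (ResidueField O)] WittVector p A →+
      (Fin (absRamification p O) → TruncatedWittVector p n A) :=
  ((WittVector.truncate n).toAddMonoidHom.compLeft _).comp
    (greenbergCoordAddEquiv p O A).symm.toAddMonoidHom

theorem coeff_greenbergTruncate_greenbergPoints {n : ℕ} {A : Type v} [CommRing A]
    [Algebra (ResidueField O) A] (φ : greenbergRing p O →ₐ[ResidueField O] A)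
    (i : Fin (absRamification p O)) (m : Fin n) :
    (greenbergTruncate p O n A (greenbergPoints p O A φ) i).coeff m = φ (X (i, (m : ℕ))) := by
  change (WittVector.truncate n ((greenbergCoordAddEquiv p O A).symm (greenbergCoordAddEquiv p O A
    fun i => WittVector.mk p fun m => φ (X (i, m))) i)).coeff m = _
  rw [AddEquiv.symm_apply_apply, WittVector.coeff_truncate, WittVector.coeff_mk]

/-- The truncated Witt vector coordinates on the kernel of `r`. -/
noncomputable def comparisonKernelTruncate (n : ℕ) :
    comparisonKernel p ϖ ⟶
      truncatedWittGroup p n (ResidueField O) (Fin (absRamification p O)) where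
  app A := AddCommGrpCat.ofHom
    { toFun := fun x : RingHom.ker ((comparison p ϖ).app A).hom => greenbergTruncate p O n A x.1
      map_zero' := map_zero (greenbergTruncate p O n A)
      map_add' := fun x y => map_add (greenbergTruncate p O n A) x.1 y.1 }
  naturality A B f := by
    refine AddCommGrpCat.hom_ext (AddMonoidHom.ext fun x : RingHom.ker _ => funext fun i => ?_)
    obtain ⟨y, hy⟩ := (greenbergCoordAddEquiv p O A).surjective x.1
    change WittVector.truncate n ((greenbergCoordAddEquiv p O B).symm
        (Algebra.TensorProduct.map (AlgHom.id O O) (wittMapAlgHom p f.hom) x.1) i) =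
      truncatedWittMap n (f.hom : A →+* B)
        (WittVector.truncate n ((greenbergCoordAddEquiv p O A).symm x.1 i))
    rw [← hy, ← greenbergCoordAddEquiv_map, AddEquiv.symm_apply_apply,
      AddEquiv.symm_apply_apply]
    exact truncate_map_eq_mk _ _

/-- The kernel of `r` as a cone over the truncated Witt vector groups. -/
noncomputable def comparisonKernelCone :
    Cone (truncatedWittTower p (ResidueField O) (Fin (absRamification p O))) where
  pt := comparisonKernel p ϖ
  π :=
    { app := fun n => comparisonKernelTruncate p ϖ n.unop.down
      naturality := fun _ _ f => NatTrans.ext <| funext fun A => AddCommGrpCat.hom_ext <|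
        AddMonoidHom.ext fun x => funext fun i =>
          (TruncatedWittVector.truncate_wittVector_truncate (ULift.down_le.mpr (leOfHom f.unop))
            ((greenbergCoordAddEquiv p O A).symm (x : RingHom.ker _).1 i)).symm }

theorem exists_isNilpotent_sub_algebraMap (h : kernelRing p ϖ) :
    ∃ a : ResidueField O, IsNilpotent (h - algebraMap (ResidueField O) _ a) := by
  obtain ⟨P, rfl⟩ := Ideal.Quotient.mk_surjective h
  obtain ⟨n, s, hs⟩ := IsPRadical.pow_mem (comparisonRingHom p ϖ).hom p P
  have hconst : (Ideal.Quotient.mkₐ (ResidueField O) (kernelIdeal p ϖ)).comp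
      (comparisonCoord p ϖ).hom =
        (Algebra.ofId (ResidueField O) _).comp (aeval fun _ => (0 : ResidueField O)) :=
    algHom_ext fun i => by
      rw [AlgHom.comp_apply, AlgHom.comp_apply, aeval_X, map_zero]
      exact Ideal.Quotient.eq_zero_iff_mem.mpr (Ideal.subset_span ⟨i, rfl⟩)
  obtain ⟨a, ha⟩ := (iterateFrobeniusEquiv (ResidueField O) p n).surjective
    (aeval (fun _ => (0 : ResidueField O)) s)
  have hpow : (P - C a) ^ p ^ n = (comparisonCoord p ϖ).hom s -
      C (aeval (fun _ => (0 : ResidueField O)) s) := by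
    rw [sub_pow_char_pow, ← hs, ← map_pow, ← ha, iterateFrobeniusEquiv_apply]
    rfl
  refine ⟨a, p ^ n, (map_pow (Ideal.Quotient.mk (kernelIdeal p ϖ)) (P - C a) (p ^ n)).symm.trans ?_⟩
  rw [hpow, map_sub, sub_eq_zero]
  exact DFunLike.congr_fun hconst s

theorem coordinateHom_comparisonKernelTruncate_X {n : ℕ} (i : Fin (absRamification p O))
    (m : Fin n) :
    (coordinateHom (comparisonKernelTruncate p ϖ n) (comparisonKernelCorepresentableBy p ϖ)
      (truncatedWittGroupCorepresentableBy p n (ResidueField O) _)).hom (X (i, m)) =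
        Ideal.Quotient.mkₐ (ResidueField O) (kernelIdeal p ϖ) (X (i, (m : ℕ))) :=
  (aeval_X _ _).trans (coeff_greenbergTruncate_greenbergPoints p
    (Ideal.Quotient.mkₐ (ResidueField O) (kernelIdeal p ϖ)) i m)

theorem isProInfinitesimal_comparisonKernel : IsProInfinitesimal (comparisonKernel p ϖ) := by
  have (n : (ULift.{u} ℕ)ᵒᵖ) : Algebra.FiniteType (ResidueField O) (CommAlgCat.of (ResidueField O)
      (MvPolynomial (Fin (absRamification p O) × Fin n.unop.down) (ResidueField O))) :=
    inferInstanceAs (Algebra.FiniteType _ (MvPolynomial _ _))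
  refine isProInfinitesimal_of_cone (comparisonKernelCone p ϖ)
    (comparisonKernelCorepresentableBy p ϖ)
    (fun n => truncatedWittGroupCorepresentableBy p n.unop.down (ResidueField O) _) ?_
    (exists_isNilpotent_sub_algebraMap p ϖ)
  let π := Ideal.Quotient.mkₐ (ResidueField O) (kernelIdeal p ϖ)
  have htop : (Algebra.adjoin (ResidueField O) (Set.range X)).map π = ⊤ := by
    rw [adjoin_range_X, Algebra.map_top, AlgHom.range_eq_top]
    exact Ideal.Quotient.mkₐ_surjective _ _
  rw [AlgHom.map_adjoin] at htop
  refine top_le_iff.mp (htop.ge.trans (Algebra.adjoin_le ?_))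
  rintro _ ⟨_, ⟨⟨i, m⟩, rfl⟩, rfl⟩
  refine (le_iSup _ (Opposite.op ⟨m + 1⟩) : _ ≤ (_ : Subalgebra _ _)) ?_
  exact ⟨X (i, Fin.last m), coordinateHom_comparisonKernelTruncate_X p ϖ i (Fin.last m)⟩

end ComparisonKernel

theorem theorem5p2 (p : ℕ) [Fact p.Prime] (O : Type u) [CommRing O] [IsDomain O]
    [IsDiscreteValuationRing O] [IsAdicComplete (maximalIdeal O) O] [CharZero O]
    [Finite (ResidueField O)] [CharP (ResidueField O) p] (ϖ : Uniformizer O) :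
    IsIso (perfectionMap p (comparisonRingHom p ϖ)) ∧
      IsUniversalHomeomorphism (comparisonMorphism p ϖ) ∧
      AlgebraicGeometry.Surjective (comparisonMorphism p ϖ) ∧
      IsProInfinitesimal (comparisonKernel p ϖ) :=
  have hhomeo : IsUniversalHomeomorphism (comparisonMorphism p ϖ) :=
    isUniversalHomeomorphism_specMap_of_isPRadical p (comparisonRingHom p ϖ)
  have hself : IsHomeomorph (comparisonMorphism p ϖ) := hhomeo _ _ _ IsPullback.of_id_snd
  ⟨isIso_perfectionMap p (comparisonRingHom p ϖ), hhomeo, ⟨hself.surjective⟩,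
    isProInfinitesimal_comparisonKernel p ϖ⟩
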